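/- Let $n\ge 1$ and let $M$ be a non-empty smooth (Hausdorff) manifold of dimension $2n+1$ with an almost contact B-metric structure $(\varphi,\xi,\eta,g)$: $\varphi$ is a smooth endomorphism of $TM$, $\xi$ a smooth vector field, $\eta$ a smooth 1-form and $g$ a smooth pseudo-Riemannian metric of signature $(n+1,n)$ such that $$\varphi\xi=0,\quad \varphi^2=-\mathrm{id}+\eta\otimes\xi,\quad \eta\circ\varphi=0,\quad \eta(\xi)=1,\quad g(\varphi x,\varphi y)=-g(x,y)+\eta(x)\eta(y).$$ Let $\nabla$ be the Levi-Civita connection of $g$, let $\rho$ be its Ricci tensor, i.e. $\rho(y,z)$ is the trace of $x\mapsto R(x,y)z$ with $R(x,y)z=\nabla_x\nabla_yz-\nabla_y\nabla_xz-\nabla_{[x,y]}z$, and let $\tilde g(x,y)=g(x,\varphi y)+\eta(x)\eta(y)$ be the associated metric. Suppose that the structure is Sasaki-like, i.e. for all vector fields $x,y$ $$(\nabla_x\varphi)y=-g(x,y)\xi-\eta(y)x+2\eta(x)\eta(y)\xi,$$ and that it admits a Ricci-like soliton with potential a smooth vector field $v$ and real constants $(\lambda,\mu,\nu)$, i.e.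 $$\tfrac12\mathcal L_vg+\rho+\lambda g+\mu\tilde g+\nu\,\eta\otimes\eta=0 .$$ Then $\lambda+\mu+\nu=-2n$. Moreover $\mathcal L_v\xi=0$ and $\nabla_\xi v=-\varphi v$ on $M$. -/

import Mathlib

open Bundle VectorField
open scoped Manifold ContDiff

noncomputable section

namespace BMetric

/-- The model space of a manifold of dimension `2n+1`. -/
abbrev Model (n : ℕ) : Type := EuclideanSpace ℝ (Fin (2 * n + 1))

/-- The tangent space `T_p M` of a manifold of dimension `2n+1`. -/
abbrev Tan (n : ℕ) {M : Type*} [TopologicalSpace M] [ChartedSpace (Model n) M] (p : M) : Type :=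
  TangentSpace (𝓡 (2 * n + 1)) p

/-- (Not necessarily smooth) vector fields on `M`. -/
abbrev VF (n : ℕ) (M : Type*) [TopologicalSpace M] [ChartedSpace (Model n) M] : Type _ :=
  (p : M) → Tan n p

section

variable {n : ℕ} {M : Type*} [TopologicalSpace M] [ChartedSpace (Model n) M]
  [IsManifold (𝓡 (2 * n + 1)) ∞ M]

/-- `X` is a smooth vector field, i.e. an element of `Γ(TM)`. -/
def SmoothVF (X : VF n M) : Prop :=
  ContMDiff (𝓡 (2 * n + 1)) (𝓡 (2 * n + 1)).tangent ∞
    (fun p => (TotalSpace.mk' (Model n) p (X p) : TangentBundle (𝓡 (2 * n + 1)) M))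

/-- The vector field `X` is differentiable at `p`. -/
def DiffVFAt (X : VF n M) (p : M) : Prop :=
  MDifferentiableAt (𝓡 (2 * n + 1)) (𝓡 (2 * n + 1)).tangent
    (fun q => (TotalSpace.mk' (Model n) q (X q) : TangentBundle (𝓡 (2 * n + 1)) M)) p

/-- The derivative `(X f)(p) = df_p (X p)` of a real function along a vector field. -/
def dirDeriv (X : VF n M) (f : M → ℝ) (p : M) : ℝ :=
  mvfderiv (𝓡 (2 * n + 1)) f p (X p)

end

/-- An almost contact B-metric structure `(φ, ξ, η, g)` on a smooth manifold `M` of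
dimension `2n+1`. -/
structure AlmostContactBMetric (n : ℕ) (M : Type*) [TopologicalSpace M]
    [ChartedSpace (Model n) M] [IsManifold (𝓡 (2 * n + 1)) ∞ M] where
  /-- the endomorphism `φ` of the tangent bundle -/
  phi : (p : M) → (Tan n p →L[ℝ] Tan n p)
  /-- the Reeb vector field `ξ` -/
  xi : VF n M
  /-- the 1-form `η` -/
  eta : (p : M) → (Tan n p →L[ℝ] ℝ)
  /-- the pseudo-Riemannian metric `g` -/
  g : (p : M) → (Tan n p →L[ℝ] Tan n p →L[ℝ] ℝ)
  smooth_phi : ContMDiff (𝓡 (2 * n + 1)) ((𝓡 (2 * n + 1)).prod 𝓘(ℝ, Model n →L[ℝ] Model n)) ∞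
    (fun p => (TotalSpace.mk' (Model n →L[ℝ] Model n) p (phi p) :
      TotalSpace (Model n →L[ℝ] Model n) (fun p : M => Tan n p →L[ℝ] Tan n p)))
  smooth_xi : SmoothVF xi
  smooth_eta : ContMDiff (𝓡 (2 * n + 1)) ((𝓡 (2 * n + 1)).prod 𝓘(ℝ, Model n →L[ℝ] ℝ)) ∞
    (fun p => (TotalSpace.mk' (Model n →L[ℝ] ℝ) p (eta p) :
      TotalSpace (Model n →L[ℝ] ℝ) (fun p : M => Tan n p →L[ℝ] ℝ)))
  smooth_g : ContMDiff (𝓡 (2 * n + 1))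
    ((𝓡 (2 * n + 1)).prod 𝓘(ℝ, Model n →L[ℝ] Model n →L[ℝ] ℝ)) ∞
    (fun p => (TotalSpace.mk' (Model n →L[ℝ] Model n →L[ℝ] ℝ) p (g p) :
      TotalSpace (Model n →L[ℝ] Model n →L[ℝ] ℝ)
        (fun p : M => Tan n p →L[ℝ] Tan n p →L[ℝ] ℝ)))
  g_symm : ∀ (p : M) (x y : Tan n p), g p x y = g p y x
  /-- `g` is nondegenerate of signature `(n+1, n)`: every tangent space has a `g`-orthonormal
  basis with `n+1` vectors of square `1` and `n` vectors of square `-1`. -/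
  g_signature : ∀ p : M, ∃ b : Module.Basis (Fin (n + 1) ⊕ Fin n) ℝ (Tan n p),
    (∀ i, g p (b (Sum.inl i)) (b (Sum.inl i)) = 1) ∧
    (∀ j, g p (b (Sum.inr j)) (b (Sum.inr j)) = -1) ∧
    (∀ i j, i ≠ j → g p (b i) (b j) = 0)
  phi_xi : ∀ p : M, phi p (xi p) = 0
  phi_phi : ∀ (p : M) (x : Tan n p), phi p (phi p x) = -x + eta p x • xi p
  eta_phi : ∀ (p : M) (x : Tan n p), eta p (phi p x) = 0
  eta_xi : ∀ p : M, eta p (xi p) = 1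
  g_phi_phi : ∀ (p : M) (x y : Tan n p),
    g p (phi p x) (phi p y) = -g p x y + eta p x * eta p y

section

variable {n : ℕ} {M : Type*} [TopologicalSpace M] [ChartedSpace (Model n) M]
  [IsManifold (𝓡 (2 * n + 1)) ∞ M]

/-- The associated B-metric `g̃(x, y) = g(x, φ y) + η(x) η(y)`. -/
def AlmostContactBMetric.gTilde (S : AlmostContactBMetric n M) (p : M) (x y : Tan n p) : ℝ :=
  S.g p x (S.phi p y) + S.eta p x * S.eta p y

/-- `∇_X Y` as a vector field, for an affine connection `∇`. -/
def covD (nabla : CovariantDerivative (𝓡 (2 * n + 1)) (Model n)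
    (TangentSpace (𝓡 (2 * n + 1)) : M → Type _)) (X Y : VF n M) : VF n M :=
  fun p => nabla Y p (X p)

/-- `nabla` is the Levi-Civita connection of `g`: the smooth affine connection which is
torsion-free and satisfies `X (g(Y, Z)) = g(∇_X Y, Z) + g(Y, ∇_X Z)`. -/
structure IsLeviCivita (g : (p : M) → (Tan n p →L[ℝ] Tan n p →L[ℝ] ℝ))
    (nabla : CovariantDerivative (𝓡 (2 * n + 1)) (Model n)
      (TangentSpace (𝓡 (2 * n + 1)) : M → Type _)) : Prop where
  smooth : nabla.ContMDiffCovariantDerivative ∞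
  torsion_free : ∀ (X Y : VF n M) (p : M), DiffVFAt X p → DiffVFAt Y p →
    covD nabla X Y p - covD nabla Y X p = mlieBracket (𝓡 (2 * n + 1)) X Y p
  metric : ∀ (X Y Z : VF n M) (p : M), DiffVFAt Y p → DiffVFAt Z p →
    dirDeriv X (fun q => g q (Y q) (Z q)) p
      = g p (covD nabla X Y p) (Z p) + g p (Y p) (covD nabla X Z p)

/-- The curvature `R(X, Y) Z = ∇_X ∇_Y Z - ∇_Y ∇_X Z - ∇_{[X, Y]} Z`. -/
def curvature (nabla : CovariantDerivative (𝓡 (2 * n + 1)) (Model n)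
    (TangentSpace (𝓡 (2 * n + 1)) : M → Type _)) (X Y Z : VF n M) : VF n M :=
  covD nabla X (covD nabla Y Z) - covD nabla Y (covD nabla X Z)
    - covD nabla (mlieBracket (𝓡 (2 * n + 1)) X Y) Z

/-- The standard basis of `T_p M`: the coordinate basis of the preferred chart at `p`. -/
def tanBasis (p : M) : Module.Basis (Fin (2 * n + 1)) ℝ (Tan n p) :=
  (EuclideanSpace.basisFun (Fin (2 * n + 1)) ℝ).toBasis

/-- The Ricci tensor: `ρ(Y, Z)(p)` is the trace of the endomorphism `x ↦ R(x, Y) Z` of `T_p M`,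
i.e. `∑ i, e^i (R(e_i, Y) Z)` for a basis `(e_i)` of `T_p M` with dual basis `(e^i)`. Here
each `e_i` is extended to a vector field that is smooth near `p`; for smooth `Y`, `Z` and a smooth
connection the value depends neither on the basis nor on the extensions. -/
def ricci (nabla : CovariantDerivative (𝓡 (2 * n + 1)) (Model n)
    (TangentSpace (𝓡 (2 * n + 1)) : M → Type _)) (Y Z : VF n M) (p : M) : ℝ :=
  ∑ i, (tanBasis (n := n) p).coord i
    (curvature nabla
      (FiberBundle.extend (Model n) (tanBasis (n := n) p i) : VF n M) Y Z p)

/-- The Lie derivative of a `(0,2)`-tensor: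
`(L_v g)(Y, Z) = v (g(Y, Z)) - g([v, Y], Z) - g(Y, [v, Z])`. -/
def lieDerivMetric (g : (p : M) → (Tan n p →L[ℝ] Tan n p →L[ℝ] ℝ)) (v Y Z : VF n M) (p : M) : ℝ :=
  dirDeriv v (fun q => g q (Y q) (Z q)) p
    - g p (mlieBracket (𝓡 (2 * n + 1)) v Y p) (Z p)
    - g p (Y p) (mlieBracket (𝓡 (2 * n + 1)) v Z p)

/-- The Lie derivative of the vector field `Y` along `v`, i.e. the Lie bracket `[v, Y]`. -/
def lieDerivVF (v Y : VF n M) : VF n M :=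
  mlieBracket (𝓡 (2 * n + 1)) v Y

/-- The Sasaki-like condition
`(∇_X φ) Y = -g(X, Y) ξ - η(Y) X + 2 η(X) η(Y) ξ`, where `(∇_X φ) Y = ∇_X (φ Y) - φ (∇_X Y)`
and `nabla` is the Levi-Civita connection of `g`. -/
def IsSasakiLike (S : AlmostContactBMetric n M)
    (nabla : CovariantDerivative (𝓡 (2 * n + 1)) (Model n)
      (TangentSpace (𝓡 (2 * n + 1)) : M → Type _)) : Prop :=
  ∀ X Y : VF n M, SmoothVF X → SmoothVF Y → ∀ p : M,
    covD nabla X (fun q => S.phi q (Y q)) p - S.phi p (covD nabla X Y p)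
      = -(S.g p (X p) (Y p)) • S.xi p - S.eta p (Y p) • X p
        + (2 * S.eta p (X p) * S.eta p (Y p)) • S.xi p

/-- The structure admits a Ricci-like soliton with potential `v` and constants `(lam, mu, nu)`:
`½ L_v g + ρ + lam g + mu g̃ + nu η ⊗ η = 0`. -/
def IsRicciLikeSoliton (S : AlmostContactBMetric n M)
    (nabla : CovariantDerivative (𝓡 (2 * n + 1)) (Model n)
      (TangentSpace (𝓡 (2 * n + 1)) : M → Type _))
    (v : VF n M) (lam mu nu : ℝ) : Prop :=
  ∀ Y Z : VF n M, SmoothVF Y → SmoothVF Z → ∀ p : M,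
    (1 / 2) * lieDerivMetric S.g v Y Z p + ricci nabla Y Z p + lam * S.g p (Y p) (Z p)
      + mu * S.gTilde p (Y p) (Z p) + nu * (S.eta p (Y p) * S.eta p (Z p)) = 0

end

end BMetric

end

/-! The Levi-Civita connection `∇` does not preserve `φ`, but adding a symmetric tensor
(`SasakiLike.diff`) gives a torsion-free connection `D` with `Dφ = 0`, `Dξ = 0`, `Dη = 0`. The price
is that the horizontal metric `P = g - η ⊗ η` is not parallel: with `F = P(φ ·, ·)` one has `D_ξ P =
-2F` and `D_ξ F = 2P`, a rotation of frequency 2, and no change in horizontal directions. The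
curvature of `D` vanishes as soon as one of its vector arguments is `ξ` (`R_xi`, `R_xi_left`). Hence
`D_ξ` acts as the Lie derivative along `ξ`, the Ricci tensor is `D_ξ`-invariant, and `ρ(·, ξ) = 2n
η`.

Let `c = λ + μ + ν + 2n`. The soliton equation on `(y, ξ)` gives `η(D_ξ v) = -c` and `D_ξ D_ξ v = 2
φ D_ξ v`. The first `D_ξ`-derivative of the equation removes `ρ`. Applying `D_ξ² + 4` to the result
annihilates every term except the resonant one, `η(v) P`, whose coefficient varies linearly along
`ξ`. What is left is `16 c F = 0`, so `c = 0` (`kap_mul_F`).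

Once `c = 0`, the field `U = 2v + φ D_ξ v` is `D_ξ`-parallel. Its symmetrised derivative multiplies
the complex form `P + iF` by `-4(λ + i(η(v) - μ))`, so `DU` commutes with `φ` modulo `ξ`. Comparing
second derivatives of `U` in the directions `x` and `φ x` yields Cauchy–Riemann equations for that
factor. Its real part is constant, hence so is `η(v)` (`eta_D_sq_mul`). The equation on `(y, ξ)`
then gives `D_ξ v = 0`, which is both remaining claims.

The argument is run over an abstract ring of functions and module of vector fields, and applied to
smooth functions and fields at the end. -/

set_option linter.unusedSectionVars false

/-! ### Connections, curvature and traces over a ring of functions. -/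

/-- A torsion-free affine connection on a module `X` of "vector fields" over a ring `C` of
"functions", with the Lie bracket of `X` given by `[x, y] = ∇_x y - ∇_y x`. -/
structure AffineConnection (C X : Type*) [CommRing C] [AddCommGroup X] [Module C X] where
  /-- the derivative of a function along a vector field -/
  der : X →ₗ[C] (C →+ C)
  /-- the covariant derivative -/
  D : X →ₗ[C] (X →+ X)
  der_mul : ∀ x f h, der x (f * h) = der x f * h + f * der x h
  D_smul : ∀ x f y, D x (f • y) = der x f • y + f • D x y
  jacobi : ∀ x y z, D x (D y z - D z y) - D (D y z - D z y) x
    = (D (D x y - D y x) z - D z (D x y - D y x)) + (D y (D x z - D z x) - D (D x z - D z x) y)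

namespace AffineConnection

variable {C X : Type*} [CommRing C] [AddCommGroup X] [Module C X] (N : AffineConnection C X)

/-- The Lie bracket of vector fields. -/
def br (x y : X) : X := N.D x y - N.D y x

/-- The curvature of the connection. -/
def R (x y z : X) : X := N.D x (N.D y z) - N.D y (N.D x z) - N.D (N.br x y) z

lemma der_one (x : X) : N.der x 1 = 0 := by
  have h := N.der_mul x 1 1
  simp only [mul_one, one_mul] at h
  linear_combination -h

lemma der_natCast (x : X) (k : ℕ) : N.der x (k : C) = 0 := by
  induction k with
  | zero => simp
  | succ k ih => rw [Nat.cast_succ, map_add, ih, der_one, add_zero]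

lemma der_two (x : X) : N.der x (2 : C) = 0 := by
  exact_mod_cast N.der_natCast x 2

lemma der_four (x : X) : N.der x (4 : C) = 0 := by
  exact_mod_cast N.der_natCast x 4

lemma der_eight (x : X) : N.der x (8 : C) = 0 := by
  exact_mod_cast N.der_natCast x 8

lemma br_smul (x y : X) (f : C) : N.br x (f • y) = N.der x f • y + f • N.br x y := by
  simp only [br, D_smul, map_smul, AddMonoidHom.smul_apply]
  module

lemma br_add (x y z : X) : N.br x (y + z) = N.br x y + N.br x z := by
  simp only [br, map_add, AddMonoidHom.add_apply]
  abel

lemma br_jacobi (x y z : X) :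
    N.br x (N.br y z) = N.br (N.br x y) z + N.br y (N.br x z) := N.jacobi x y z

/-- That `[x, y]` acts on functions as a commutator is not an axiom. It falls out of the Jacobi
identity for `x`, `y`, `f • z`, but only after acting on a vector field. -/
lemma der_br_smul (x y z : X) (f : C) :
    N.der (N.br x y) f • z = (N.der x (N.der y f) - N.der y (N.der x f)) • z := by
  have h := N.br_jacobi x y (f • z)
  simp only [br_smul, br_add] at h
  have h' := N.br_jacobi x y z
  linear_combination (norm := module) -h + f • h'

lemma R_antisymm (x y z : X) : N.R x y z = -N.R y x z := by
  simp only [R, br, map_sub, AddMonoidHom.sub_apply]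
  abel

lemma R_add_left (x x' y z : X) : N.R (x + x') y z = N.R x y z + N.R x' y z := by
  simp only [R, br, map_add, map_sub, AddMonoidHom.add_apply, AddMonoidHom.sub_apply]
  abel

lemma R_smul_left (f : C) (x y z : X) : N.R (f • x) y z = f • N.R x y z := by
  simp only [R, br, map_smul, map_sub, map_add, AddMonoidHom.smul_apply, AddMonoidHom.sub_apply,
    D_smul, AddMonoidHom.add_apply]
  module

lemma R_bianchi (x y z : X) : N.R x y z + N.R y z x + N.R z x y = 0 := by
  have h := N.br_jacobi x y z
  simp only [R, br, map_sub, AddMonoidHom.sub_apply] at h ⊢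
  linear_combination (norm := module) h

/-- The curvature as a linear map in its first argument. -/
def RHom (y z : X) : X →ₗ[C] X where
  toFun x := N.R x y z
  map_add' x x' := N.R_add_left x x' y z
  map_smul' f x := N.R_smul_left f x y z

/-- A family `(E_i, θ^i)` with `∑ θ^i ⊗ E_i = χ id`; where the function `χ` is invertible, it
computes traces. -/
structure TraceFrame (C X ι : Type*) [CommRing C] [AddCommGroup X] [Module C X] [Fintype ι] where
  /-- the cut-off function -/
  chi : C
  /-- the vector fields of the frame -/
  E : ι → X
  /-- the 1-forms of the coframe -/
  th : ι → X →ₗ[C] C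
  expand : ∀ x, ∑ i, th i x • E i = chi • x

variable {ι : Type*} [Fintype ι]

/-- `χ` times the trace of an endomorphism. -/
def TraceFrame.tr (T : TraceFrame C X ι) (L : X → X) : C := ∑ i, T.th i (L (T.E i))

lemma TraceFrame.tr_smulRight (T : TraceFrame C X ι) (al : X →ₗ[C] C) (y : X) :
    T.tr (fun x => al x • y) = T.chi * al y := by
  have h := congrArg al (T.expand y)
  simp only [map_sum, map_smul, smul_eq_mul] at h
  simp only [tr, map_smul, smul_eq_mul]
  rw [← h]
  exact Finset.sum_congr rfl fun i _ => mul_comm _ _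

/-- The derivative of the trace of `L` is the trace of the covariant derivative of `L`. -/
lemma TraceFrame.der_tr (T : TraceFrame C X ι) (x : X) (L : X →ₗ[C] X) :
    T.chi * N.der x (T.tr L) = T.chi * T.tr (fun e => N.D x (L e) - L (N.D x e))
      + N.der x T.chi * T.tr L := by
  -- Differentiating the expansion of `χ y` gives `∑ (D_x θ^i ⊗ E_i + θ^i ⊗ D_x E_i) = x(χ) id`.
  -- This replaces duality of frame and coframe, which is not assumed.
  have hE : ∀ y, ∑ i, ((N.der x (T.th i y) - T.th i (N.D x y)) • T.E i + T.th i y • N.D x (T.E i))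
      = N.der x T.chi • y := by
    intro y
    have h := congrArg (N.D x) (T.expand y)
    have h' := T.expand (N.D x y)
    simp only [map_sum, D_smul] at h
    simp only [sub_smul, Finset.sum_add_distrib, Finset.sum_sub_distrib] at h ⊢
    rw [h']
    linear_combination (norm := module) h
  have hex : ∀ (i : ι) (z : X), ∑ j, T.th i (L (T.E j)) * T.th j z = T.chi * T.th i (L z) := by
    intro i z
    have h := congrArg (fun w => T.th i (L w)) (T.expand z)
    simp only [map_sum, map_smul, smul_eq_mul] at h
    rw [← h]
    exact Finset.sum_congr rfl fun i _ => mul_comm _ _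
  have hid : ∀ (i : ι) (z : X), ∑ j, T.th i (T.E j) * T.th j z = T.chi * T.th i z := by
    intro i z
    have h := congrArg (T.th i) (T.expand z)
    simp only [map_sum, map_smul, smul_eq_mul] at h
    rw [← h]
    exact Finset.sum_congr rfl fun i _ => mul_comm _ _
  have h1 : ∀ j, ∑ i, ((N.der x (T.th i (T.E j)) - T.th i (N.D x (T.E j))) * T.th j (L (T.E i))
      + T.th i (T.E j) * T.th j (L (N.D x (T.E i)))) = N.der x T.chi * T.th j (L (T.E j)) := by
    intro j
    have h := congrArg (fun w => T.th j (L w)) (hE (T.E j))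
    simpa only [map_sum, map_add, map_smul, smul_eq_mul] using h
  have h2 : ∀ i, T.chi * N.der x (T.th i (L (T.E i)))
      = T.chi * T.th i (N.D x (L (T.E i))) +
        ∑ j, (N.der x (T.th i (T.E j)) - T.th i (N.D x (T.E j))) * T.th j (L (T.E i)) := by
    intro i
    have e1 : T.th i (T.chi • L (T.E i)) = ∑ j, T.th i (T.E j) * T.th j (L (T.E i)) := by
      rw [hid, map_smul, smul_eq_mul]
    have e2 := hid i (N.D x (L (T.E i)))
    have e3 := congrArg (T.th i) (hE (L (T.E i)))
    have e4 := congrArg (N.der x) (hid i (L (T.E i)))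
    simp only [map_sum, map_add, map_smul, smul_eq_mul, der_mul, Finset.sum_add_distrib, sub_mul,
      Finset.sum_sub_distrib] at e1 e2 e3 e4 ⊢
    have c1 : ∑ j, N.der x (T.th j (L (T.E i))) * T.th i (T.E j) =
      ∑ j, T.th i (T.E j) * N.der x (T.th j (L (T.E i))) :=
      Finset.sum_congr rfl fun i _ => mul_comm _ _
    have c2 : ∑ j, T.th j (N.D x (L (T.E i))) * T.th i (T.E j) =
      ∑ j, T.th i (T.E j) * T.th j (N.D x (L (T.E i))) :=
      Finset.sum_congr rfl fun i _ => mul_comm _ _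
    have c3 : ∑ j, T.th j (L (T.E i)) * T.th i (N.D x (T.E j)) =
      ∑ j, T.th i (N.D x (T.E j)) * T.th j (L (T.E i)) :=
      Finset.sum_congr rfl fun i _ => mul_comm _ _
    rw [c1, c2, c3] at e3
    linear_combination e3 - e4 + e2
  have h3 := Finset.sum_congr rfl fun j (_ : j ∈ Finset.univ) => h1 j
  have h4 := Finset.sum_congr rfl fun j (_ : j ∈ Finset.univ) => h2 j
  have h5 : ∑ j, ∑ i, T.th i (T.E j) * T.th j (L (N.D x (T.E i)))
      = ∑ i, T.chi * T.th i (L (N.D x (T.E i))) := by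
    rw [Finset.sum_comm]
    exact Finset.sum_congr rfl fun i _ => hid i _
  simp only [Finset.sum_add_distrib] at h3 h4
  rw [h5] at h3
  rw [Finset.sum_comm] at h3
  simp only [tr, map_sum, map_sub, Finset.sum_sub_distrib, mul_sub, Finset.mul_sum]
  linear_combination h3 + h4

end AffineConnection

/-! ### Torsion-free connections preserving the contact structure. -/

namespace AffineConnection

lemma eq_zero_of_two_mul {C : Type*} [CommRing C] [Algebra ℝ C] {c : C} (h : 2 * c = 0) :
    c = 0 := by
  have h2 : (2 : ℝ) • c = 0 := by rw [ofNat_smul_eq_nsmul, nsmul_eq_mul]; exact_mod_cast h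
  exact (smul_eq_zero_iff_right two_ne_zero).1 h2

variable {C X : Type*} [CommRing C] [AddCommGroup X] [Module C X]

/-- A connection preserving an almost contact structure `(φ, ξ, η)`, together with a symmetric
form `P` with kernel spanned by `ξ`, for which `φ` is self-adjoint and
`∇_z P = -2 η(z) P(φ ·, ·)`. -/
structure ContactParallel (N : AffineConnection C X) where
  /-- the endomorphism `φ` -/
  phi : X →ₗ[C] X
  /-- the Reeb field -/
  xi : X
  /-- the contact form -/
  eta : X →ₗ[C] C
  /-- the horizontal part of the metric -/
  P : X →ₗ[C] X →ₗ[C] C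
  phi_phi : ∀ x, phi (phi x) = -x + eta x • xi
  phi_xi : phi xi = 0
  eta_phi : ∀ x, eta (phi x) = 0
  eta_xi : eta xi = 1
  P_symm : ∀ x y, P x y = P y x
  P_xi : ∀ y, P xi y = 0
  P_phi : ∀ x y, P (phi x) y = P x (phi y)
  nondeg : ∀ x, (∀ y, P x y = 0) → phi x = 0
  D_xi : ∀ x, N.D x xi = 0
  D_phi : ∀ x y, N.D x (phi y) = phi (N.D x y)
  D_eta : ∀ x y, N.der x (eta y) = eta (N.D x y)
  D_P : ∀ z x y, N.der z (P x y) = P (N.D z x) y + P x (N.D z y) - 2 * eta z * P (phi x) y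

namespace ContactParallel

variable {N : AffineConnection C X} (S : N.ContactParallel)

/-- The form `F(x, y) = P(φ x, y)`. -/
def F (x y : X) : C := S.P (S.phi x) y

lemma F_eq (x y : X) : S.F x y = S.P x (S.phi y) := S.P_phi x y

lemma F_symm (x y : X) : S.F x y = S.F y x := by
  rw [F_eq, F, S.P_symm]

lemma P_xi_right (x : X) : S.P x S.xi = 0 := by rw [S.P_symm, S.P_xi]

lemma F_phi (x y : X) : S.F (S.phi x) y = -S.P x y := by
  simp [F, S.phi_phi, S.P_xi]

lemma F_phi_right (x y : X) : S.F x (S.phi y) = -S.P x y := by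
  rw [S.F_symm, S.F_phi, S.P_symm]

lemma eq_of_P_eq {x y : X} (h : ∀ z, S.P x z = S.P y z) (h' : S.eta x = S.eta y) : x = y := by
  have h1 := S.nondeg (x - y) fun z => by simp [h z]
  have h2 := S.phi_phi (x - y)
  rw [h1, map_zero, map_sub, h', sub_self, zero_smul, add_zero, eq_comm, neg_eq_zero] at h2
  exact sub_eq_zero.1 h2

lemma D_F (z x y : X) :
    N.der z (S.F x y) = S.F (N.D z x) y + S.F x (N.D z y) + 2 * S.eta z * S.P x y := by
  rw [F, S.D_P, S.D_phi]
  have h := S.F_phi x y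
  simp only [F] at h ⊢
  rw [h]
  ring

/-- Since `η(ξ) = 1`, the vector field in `der_br_smul` can be taken to be `ξ` and stripped off by
`η`. -/
lemma der_br (S : N.ContactParallel) (x y : X) (f : C) :
    N.der (N.br x y) f = N.der x (N.der y f) - N.der y (N.der x f) := by
  have h := congrArg S.eta (N.der_br_smul x y S.xi f)
  simpa [S.eta_xi] using h

lemma R_xi (x y : X) : N.R x y S.xi = 0 := by
  simp [R, S.D_xi]

lemma R_phi (x y z : X) : N.R x y (S.phi z) = S.phi (N.R x y z) := by
  simp only [R, S.D_phi, map_sub]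

lemma eta_R (x y z : X) : S.eta (N.R x y z) = 0 := by
  have h := S.der_br x y (S.eta z)
  simp only [S.D_eta] at h
  simp only [R, map_sub]
  linear_combination -h

lemma eta_br (x y : X) : S.eta (N.br x y) = N.der x (S.eta y) - N.der y (S.eta x) := by
  simp only [br, map_sub, S.D_eta]

/-- Although `P` is not parallel, its defect is `-2 η ⊗ F`. The second-order corrections cancel
because `η` is closed and `η ∧ η = 0`. -/
lemma R_skew (x y z w : X) : S.P (N.R x y z) w = -S.P z (N.R x y w) := by
  have h := S.der_br x y (S.P z w)
  have hF := S.D_F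
  have he := S.eta_br x y
  have e : ∀ u v, S.P (S.phi u) v = S.F u v := fun _ _ => rfl
  have n : ∀ t a b c : C, N.der x (a + b - 2 * t * c) =
      N.der x a + N.der x b - 2 * N.der x t * c - 2 * t * N.der x c := fun t a b c => by
    rw [two_mul, map_sub, der_mul, map_add, map_add]; ring
  have n' : ∀ t a b c : C, N.der y (a + b - 2 * t * c) =
      N.der y a + N.der y b - 2 * N.der y t * c - 2 * t * N.der y c := fun t a b c => by
    rw [two_mul, map_sub, der_mul, map_add, map_add]; ring
  simp only [S.D_P, e, n, n', hF, he] at h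
  simp only [R, map_sub, LinearMap.sub_apply]
  linear_combination -h

lemma F_xi (y : X) : S.F S.xi y = 0 := by simp [F, S.phi_xi]

lemma F_xi_right (y : X) : S.F y S.xi = 0 := by rw [S.F_symm, F_xi]

variable [Algebra ℝ C]

/-- By the Bianchi identity and `R_xi`, the form `P(R(ξ, x) y, z)` is symmetric in `x, y`. By
`R_skew` it is skew in `y, z`. A trilinear form with both symmetries vanishes. -/
lemma R_xi_left (x y : X) : N.R S.xi x y = 0 := by
  have hs : ∀ x y, N.R S.xi x y = N.R S.xi y x := by
    intro x y
    have h := N.R_bianchi S.xi x y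
    rw [S.R_xi, N.R_antisymm y S.xi x, add_zero] at h
    exact add_neg_eq_zero.1 h
  apply S.eq_of_P_eq
  · intro z
    have key : ∀ x y z, S.P (N.R S.xi x y) z = -S.P (N.R S.xi x z) y := fun x y z => by
      rw [S.R_skew, S.P_symm]
    have h1 := key x y z
    rw [hs x z] at h1
    have h2 := key z x y
    rw [hs z y] at h2
    have h3 := key y z x
    rw [hs y x] at h3
    rw [map_zero, LinearMap.zero_apply]
    apply eq_zero_of_two_mul
    linear_combination h1 - h2 + h3
  · rw [S.eta_R, map_zero]

end ContactParallel
end AffineConnection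

/-! ### The soliton equation differentiated along `ξ`. -/

namespace AffineConnection

variable {C X : Type*} [CommRing C] [AddCommGroup X] [Module C X] [Algebra ℝ C]

namespace ContactParallel

variable {N : AffineConnection C X} (S : N.ContactParallel)

/-- This is `R(ξ, y) z = 0`, where `[ξ, y] = D_ξ y` because `ξ` is parallel: `D_ξ` is a derivation
of the connection itself. -/
lemma D_xi_D (y z : X) :
    N.D S.xi (N.D y z) = N.D y (N.D S.xi z) + N.D (N.D S.xi y) z := by
  have h := S.R_xi_left y z
  simp only [R, br, S.D_xi, sub_zero] at h
  linear_combination (norm := module) h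

lemma D_xi_br (x y : X) :
    N.D S.xi (N.br x y) = N.br (N.D S.xi x) y + N.br x (N.D S.xi y) := by
  simp only [br, map_sub, S.D_xi_D]
  abel

lemma D_xi_R (x y z : X) : N.D S.xi (N.R x y z)
    = N.R (N.D S.xi x) y z + N.R x (N.D S.xi y) z + N.R x y (N.D S.xi z) := by
  have h := S.D_xi_br x y
  simp only [R, map_sub, map_add, S.D_xi_D, h, AddMonoidHom.add_apply]
  abel

/-- The soliton equation for the potential `v`, written in terms of a connection preserving the
contact structure. Here `rho` is a symmetric bilinear form which is parallel along `ξ`, and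
`c = λ + μ + ν + 2n`. -/
structure Soliton where
  /-- the potential -/
  v : X
  /-- the Ricci form -/
  rho : X → X → C
  /-- the coefficient of the horizontal metric -/
  lam : C
  /-- the coefficient of `F` -/
  mu : C
  /-- the coefficient of `η ⊗ η` -/
  kap : C
  /-- the value of `ρ(ξ, ξ)` -/
  m : C
  der_lam : ∀ x, N.der x lam = 0
  der_mu : ∀ x, N.der x mu = 0
  der_kap : ∀ x, N.der x kap = 0
  der_m : ∀ x, N.der x m = 0
  rho_xi : ∀ y, rho y S.xi = m * S.eta y
  der_rho : ∀ y z, N.der S.xi (rho y z) = rho (N.D S.xi y) z + rho y (N.D S.xi z)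
  eqn : ∀ y z, S.P (N.D y v) z + S.P y (N.D z v) + S.eta (N.D y v) * S.eta z
    + S.eta y * S.eta (N.D z v) - 2 * S.eta v * S.F y z
    + 2 * (rho y z + lam * S.P y z + mu * S.F y z + kap * (S.eta y * S.eta z)) = 0

namespace Soliton

variable {S} (Q : S.Soliton)

lemma eta_D_xi : S.eta (N.D S.xi Q.v) = -(Q.m + Q.kap) := by
  have h := Q.eqn S.xi S.xi
  simp only [S.P_xi, S.P_xi_right, S.eta_xi, S.F_xi, Q.rho_xi] at h
  have h' : 2 * (S.eta (N.D S.xi Q.v) + (Q.m + Q.kap)) = 0 := by linear_combination h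
  linear_combination eq_zero_of_two_mul h'

lemma P_D_xi (y : X) :
    S.P y (N.D S.xi Q.v) = -S.eta (N.D y Q.v) - (Q.m + Q.kap) * S.eta y := by
  have h := Q.eqn y S.xi
  simp only [S.P_xi_right, S.eta_xi, S.F_xi_right, Q.rho_xi, Q.eta_D_xi] at h
  linear_combination h

/-- Differentiate `P_D_xi` along `ξ`: its right side is `D_ξ`-invariant, so only `D_ξ P = -2F`
contributes, and it produces the term `2 φ`. -/
lemma D_xi_D_xi : N.D S.xi (N.D S.xi Q.v) = (2 : C) • S.phi (N.D S.xi Q.v) := by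
  apply S.eq_of_P_eq
  · intro z
    have h := congrArg (N.der S.xi) (Q.P_D_xi z)
    have h' := Q.P_D_xi (N.D S.xi z)
    simp only [S.D_P, map_sub, map_neg, S.D_eta, S.D_xi_D z, map_add, der_mul, Q.der_m, Q.der_kap,
      S.eta_xi] at h
    have h1 := congrArg (N.der z) Q.eta_D_xi
    simp only [S.D_eta, map_neg, map_add, Q.der_m, Q.der_kap] at h1
    have h2 := S.P_symm z (N.D S.xi (N.D S.xi Q.v))
    have h3 := S.P_phi z (N.D S.xi Q.v)
    have h4 := S.P_symm z (S.phi (N.D S.xi Q.v))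
    simp only [map_smul, LinearMap.smul_apply, smul_eq_mul]
    linear_combination h - h2 - h' - h1 + 2 * h3 + 2 * h4
  · have h := congrArg (N.der S.xi) Q.eta_D_xi
    simp only [S.D_eta, map_neg, map_add, Q.der_m, Q.der_kap] at h
    rw [h, map_smul, S.eta_phi]
    simp

lemma der_xi_P_D (y z : X) : N.der S.xi (S.P (N.D y Q.v) z) = S.P (N.D y (N.D S.xi Q.v)) z
    - 2 * S.F (N.D y Q.v) z + S.P (N.D (N.D S.xi y) Q.v) z + S.P (N.D y Q.v) (N.D S.xi z) := by
  rw [S.D_P, S.D_xi_D, map_add, LinearMap.add_apply, S.eta_xi, F]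
  ring

lemma der_xi_F_D (y z : X) : N.der S.xi (S.F (N.D y Q.v) z) = S.F (N.D y (N.D S.xi Q.v)) z
    + 2 * S.P (N.D y Q.v) z + S.F (N.D (N.D S.xi y) Q.v) z + S.F (N.D y Q.v) (N.D S.xi z) := by
  rw [S.D_F, S.D_xi_D, S.eta_xi]
  simp only [F, map_add, LinearMap.add_apply]
  ring

/-- The derivative `2 φ D_ξ v` of `D_ξ v` exactly compensates `D_ξ P = -2F`, so `P(D_y D_ξ v, z)` is
an invariant tensor along `ξ`. -/
lemma der_xi_P_DD (y z : X) : N.der S.xi (S.P (N.D y (N.D S.xi Q.v)) z)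
    = S.P (N.D (N.D S.xi y) (N.D S.xi Q.v)) z + S.P (N.D y (N.D S.xi Q.v)) (N.D S.xi z) := by
  rw [S.D_P, S.D_xi_D y, Q.D_xi_D_xi, N.D_smul, S.D_phi, der_two, S.eta_xi]
  simp only [zero_smul, zero_add, map_add, map_smul, LinearMap.add_apply, LinearMap.smul_apply,
    smul_eq_mul]
  ring

lemma der_xi_F_DD (y z : X) : N.der S.xi (S.F (N.D y (N.D S.xi Q.v)) z)
    = S.F (N.D (N.D S.xi y) (N.D S.xi Q.v)) z + S.F (N.D y (N.D S.xi Q.v)) (N.D S.xi z) := by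
  rw [S.F_eq, Q.der_xi_P_DD, S.D_phi, S.F_eq, S.F_eq]

lemma der_xi_eta (y : X) : N.der S.xi (S.eta (N.D y Q.v)) = S.eta (N.D (N.D S.xi y) Q.v) := by
  have h := congrArg (N.der y) Q.eta_D_xi
  simp only [S.D_eta, map_neg, map_add, Q.der_m, Q.der_kap] at h
  rw [S.D_eta, S.D_xi_D, map_add, h]
  ring

lemma eqn_one (y z : X) : -2 * S.F (N.D y Q.v) z - 2 * S.F (N.D z Q.v) y
    + S.P (N.D y (N.D S.xi Q.v)) z + S.P (N.D z (N.D S.xi Q.v)) y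
    + 2 * (Q.m + Q.kap) * S.F y z - 4 * S.eta Q.v * S.P y z - 4 * Q.lam * S.F y z
    + 4 * Q.mu * S.P y z = 0 := by
  have hs : ∀ y z, S.P y (N.D z Q.v) = S.P (N.D z Q.v) y := fun y z => S.P_symm _ _
  have h0 := congrArg (N.der S.xi) (Q.eqn y z)
  have h1 := Q.eqn (N.D S.xi y) z
  have h2 := Q.eqn y (N.D S.xi z)
  have hP : S.P (S.phi y) z = S.F y z := rfl
  simp only [hs] at h0 h1 h2
  simp only [map_add, map_sub, map_zero, der_mul, der_two, der_xi_P_D, der_xi_eta, S.D_eta _ y,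
    S.D_eta _ z, S.D_eta _ Q.v, Q.eta_D_xi, Q.der_rho, Q.der_lam, Q.der_mu, Q.der_kap,
    S.D_F S.xi y z, S.D_P S.xi y z, S.eta_xi, hP] at h0
  -- Subtracting the equation at `(D_ξ y, z)` and at `(y, D_ξ z)` turns the derivative of a function
  -- into the `D_ξ`-derivative of the tensor equation.
  linear_combination h0 - h1 - h2

lemma eqn_two (y z : X) : -4 * S.P (N.D y Q.v) z - 4 * S.P (N.D z Q.v) y
    - 2 * S.F (N.D y (N.D S.xi Q.v)) z - 2 * S.F (N.D z (N.D S.xi Q.v)) y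
    + 8 * (Q.m + Q.kap) * S.P y z + 8 * S.eta Q.v * S.F y z - 8 * Q.lam * S.P y z
    - 8 * Q.mu * S.F y z = 0 := by
  have h0 := congrArg (N.der S.xi) (Q.eqn_one y z)
  have h1 := Q.eqn_one (N.D S.xi y) z
  have h2 := Q.eqn_one y (N.D S.xi z)
  have hP : S.P (S.phi y) z = S.F y z := rfl
  simp only [map_add, map_sub, map_neg, map_zero, neg_mul, der_mul, der_two, der_four, der_xi_F_D,
    der_xi_P_DD, S.D_eta _ Q.v, Q.eta_D_xi, Q.der_lam, Q.der_mu, Q.der_kap, Q.der_m,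
    S.D_F S.xi y z, S.D_P S.xi y z, S.eta_xi, hP] at h0
  linear_combination h0 - h1 - h2

lemma kap_mul_F (y z : X) : (Q.m + Q.kap) * S.F y z = 0 := by
  have h0 := congrArg (N.der S.xi) (Q.eqn_two y z)
  have h1 := Q.eqn_two (N.D S.xi y) z
  have h2 := Q.eqn_two y (N.D S.xi z)
  have h3 := Q.eqn_one y z
  have hP : S.P (S.phi y) z = S.F y z := rfl
  simp only [map_add, map_sub, map_neg, map_zero, neg_mul, der_mul, der_two, der_four, der_eight, der_xi_P_D,
    der_xi_F_DD, S.D_eta _ Q.v, Q.eta_D_xi, Q.der_lam, Q.der_mu, Q.der_kap, Q.der_m,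
    S.D_F S.xi y z, S.D_P S.xi y z, S.eta_xi, hP] at h0
  apply eq_zero_of_two_mul
  apply eq_zero_of_two_mul
  apply eq_zero_of_two_mul
  apply eq_zero_of_two_mul
  -- The third derivative plus four times the first: only `-16 (m + κ) F` survives, whence the four
  -- halvings above.
  linear_combination h1 + h2 - h0 - 4 * h3

/-! ### The field `U` and the Cauchy–Riemann argument for `η(v)`. -/

/-- Twice the part of the potential commuting with `ξ`. -/
def U : X := (2 : C) • Q.v + S.phi (N.D S.xi Q.v)

lemma D_U (y : X) : N.D y Q.U = (2 : C) • N.D y Q.v + S.phi (N.D y (N.D S.xi Q.v)) := by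
  rw [U, map_add, N.D_smul, der_two, S.D_phi, zero_smul, zero_add]

/-- `U` is chosen so that half of `eqn_two` becomes its symmetrised `P`-derivative; `eqn_one`
likewise becomes the one for `F`. -/
lemma P_D_U (hc : Q.m + Q.kap = 0) (y z : X) : S.P (N.D y Q.U) z + S.P y (N.D z Q.U)
    = 4 * (S.eta Q.v - Q.mu) * S.F y z - 4 * Q.lam * S.P y z := by
  have h := Q.eqn_two y z
  rw [S.P_symm y]
  simp only [D_U, map_add, map_smul, LinearMap.add_apply, LinearMap.smul_apply, smul_eq_mul]
  simp only [F, hc] at h ⊢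
  rw [← sub_eq_zero]
  apply eq_zero_of_two_mul
  linear_combination -h

lemma F_D_U (hc : Q.m + Q.kap = 0) (y z : X) : S.F (N.D y Q.U) z + S.F y (N.D z Q.U)
    = -4 * (S.eta Q.v - Q.mu) * S.P y z - 4 * Q.lam * S.F y z := by
  have h := Q.eqn_one y z
  have h1 := S.F_phi (N.D y (N.D S.xi Q.v)) z
  have h2 := S.F_phi (N.D z (N.D S.xi Q.v)) y
  rw [S.F_symm y]
  simp only [F, hc, D_U, map_add, map_smul, LinearMap.add_apply, LinearMap.smul_apply,
    smul_eq_mul] at h h1 h2 ⊢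
  linear_combination -h + h1 + h2

/-- The covariant derivative of `U` commutes with `φ` up to a multiple of `ξ`. -/
lemma D_phi_U (hc : Q.m + Q.kap = 0) (x : X) :
    N.D (S.phi x) Q.U = S.phi (N.D x Q.U) + S.eta (N.D (S.phi x) Q.U) • S.xi := by
  apply S.eq_of_P_eq
  · intro z
    have h1 := Q.P_D_U hc (S.phi x) z
    have h2 := Q.F_D_U hc x z
    rw [S.F_phi] at h1
    simp only [map_add, map_smul, LinearMap.add_apply, LinearMap.smul_apply, S.P_xi, smul_zero,
      add_zero]
    simp only [F] at h1 h2
    linear_combination h1 - h2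
  · rw [map_add, map_smul, S.eta_phi, S.eta_xi, smul_eq_mul, mul_one, zero_add]

/-- The second covariant derivative of `U`. -/
def T (x y : X) : X := N.D x (N.D y Q.U) - N.D (N.D x y) Q.U

lemma T_sub_T (x y : X) : Q.T x y - Q.T y x = N.R x y Q.U := by
  simp only [T, R, br, map_sub, AddMonoidHom.sub_apply]
  abel

lemma P_T_phi (hc : Q.m + Q.kap = 0) (x y z : X) :
    S.P (Q.T x (S.phi y)) z = S.F (Q.T x y) z := by
  rw [T, T, S.D_phi, Q.D_phi_U hc y, Q.D_phi_U hc (N.D x y), map_add, N.D_smul, S.D_xi, S.D_phi]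
  simp [F, S.P_xi]

/-- Differentiate `P_D_U`. As `λ` and `μ` are constants, only `η(v)` contributes; the term from `DP
≠ 0` is absorbed by `F_D_U`. -/
lemma P_T (hc : Q.m + Q.kap = 0) (x y z : X) :
    S.P (Q.T x y) z + S.P y (Q.T x z) = 4 * S.eta (N.D x Q.v) * S.F y z := by
  have h0 := congrArg (N.der x) (Q.P_D_U hc y z)
  have h1 := Q.P_D_U hc (N.D x y) z
  have h2 := Q.P_D_U hc y (N.D x z)
  have h3 := Q.F_D_U hc y z
  simp only [map_add, map_sub, der_mul, der_four, S.D_eta, Q.der_lam, Q.der_mu, S.D_F,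
    S.D_P] at h0
  simp only [T, map_sub, LinearMap.sub_apply]
  simp only [F] at h0 h1 h2 h3 ⊢
  have h4 := S.P_phi y (N.D z Q.U)
  linear_combination h0 - h1 - h2 + 2 * S.eta x * h3

lemma F_T (hc : Q.m + Q.kap = 0) (x y z : X) :
    S.F (Q.T x y) z + S.F y (Q.T x z) = -4 * S.eta (N.D x Q.v) * S.P y z := by
  have h0 := congrArg (N.der x) (Q.F_D_U hc y z)
  have h1 := Q.F_D_U hc (N.D x y) z
  have h2 := Q.F_D_U hc y (N.D x z)
  have h3 := Q.P_D_U hc y z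
  simp only [map_add, map_sub, map_neg, neg_mul, der_mul, der_four, S.D_eta, Q.der_lam, Q.der_mu,
    S.D_F, S.D_P] at h0
  simp only [T, map_sub, LinearMap.sub_apply, F] at h0 h1 h2 h3 ⊢
  linear_combination h0 - h1 - h2 - 2 * S.eta x * h3

lemma eta_D_mul (hc : Q.m + Q.kap = 0) (x y z : X) :
    S.eta (N.D (S.phi x) Q.v) * S.F y z + S.eta (N.D x Q.v) * S.P y z = 0 := by
  -- Swapping arguments of `T` costs curvature, so `T (φ x) y` equals `φ (T x y)` up to curvature
  -- terms and multiples of `ξ`. The Bianchi identity rewrites the error as a form skew in `y, z`,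
  -- which disappears on symmetrising.
  have key : ∀ y z, S.P (Q.T (S.phi x) y) z = S.F (Q.T x y) z
      + (S.F (N.R Q.U x y) z - S.P (N.R Q.U (S.phi x) y) z) := by
    intro y z
    have h1 := congrArg (fun w => S.P w z) (Q.T_sub_T (S.phi x) y)
    have h2 := congrArg (fun w => S.F w z) (Q.T_sub_T y x)
    have h3 := Q.P_T_phi hc y x z
    have h4 := congrArg (fun w => S.P w z) (N.R_bianchi (S.phi x) y Q.U)
    have h5 := congrArg (fun w => S.F w z) (N.R_bianchi y x Q.U)
    simp only [N.R_antisymm y Q.U, N.R_antisymm x Q.U, S.R_phi] at h4 h5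
    simp only [map_add, map_sub, map_neg, map_zero, LinearMap.add_apply, LinearMap.sub_apply,
      LinearMap.neg_apply, LinearMap.zero_apply, F] at h1 h2 h3 h4 h5 ⊢
    linear_combination h1 + h2 + h3 + h4 + h5
  have h1 := Q.P_T hc (S.phi x) y z
  have h2 := Q.F_T hc x y z
  rw [S.P_symm y, key, key] at h1
  rw [S.F_symm y] at h2
  have r1 := S.R_skew Q.U (S.phi x) y z
  rw [S.P_symm y] at r1
  have r2 : S.F (N.R Q.U x y) z = -S.F (N.R Q.U x z) y := by
    rw [S.F_eq, S.R_skew, S.R_phi, S.P_symm, F]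
  apply eq_zero_of_two_mul
  apply eq_zero_of_two_mul
  linear_combination -h1 + h2 + r2 - r1

/-- The function `η(v)` is constant in the horizontal directions. -/
lemma eta_D_sq_mul (hc : Q.m + Q.kap = 0) (x y z : X) :
    (S.eta (N.D (S.phi x) Q.v) ^ 2 + S.eta (N.D x Q.v) ^ 2) * S.P y z = 0 := by
  have h1 := Q.eta_D_mul hc x y z
  have h2 := Q.eta_D_mul hc x y (S.phi z)
  rw [S.F_phi_right, ← S.F_eq] at h2
  linear_combination S.eta (N.D x Q.v) * h1 - S.eta (N.D (S.phi x) Q.v) * h2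

end Soliton
end ContactParallel
end AffineConnection

/-! ### From the Levi-Civita connection of a Sasaki-like structure to the parallel one. -/

namespace AffineConnection

variable {C X : Type*} [CommRing C] [AddCommGroup X] [Module C X]

/-- The torsion-free connection `∇ + S` for a symmetric tensor field `S`. -/
def addSymm (N : AffineConnection C X) (S : X →ₗ[C] X →ₗ[C] X) (hS : ∀ x y, S x y = S y x) :
    AffineConnection C X where
  der := N.der
  D :=
    { toFun := fun x => N.D x + (S x).toAddMonoidHom
      map_add' := fun x y => by ext z; simp; abel
      map_smul' := fun f x => by ext z; simp }
  der_mul := N.der_mul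
  D_smul x f y := by simp [N.D_smul]; module
  jacobi x y z := by
    have h : ∀ x y, (N.D x + (S x).toAddMonoidHom) y - (N.D y + (S y).toAddMonoidHom) x
        = N.br x y := fun x y => by simp [br, hS x y]
    simpa only [LinearMap.coe_mk, AddHom.coe_mk, h] using! N.br_jacobi x y z

/-- A Sasaki-like almost contact B-metric structure, with Levi-Civita connection `N`. -/
structure SasakiLike (N : AffineConnection C X) where
  /-- the endomorphism `φ` -/
  phi : X →ₗ[C] X
  /-- the Reeb field -/
  xi : X
  /-- the contact form -/
  eta : X →ₗ[C] C
  /-- the metric -/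
  g : X →ₗ[C] X →ₗ[C] C
  phi_phi : ∀ x, phi (phi x) = -x + eta x • xi
  phi_xi : phi xi = 0
  eta_phi : ∀ x, eta (phi x) = 0
  eta_xi : eta xi = 1
  g_symm : ∀ x y, g x y = g y x
  g_phi_phi : ∀ x y, g (phi x) (phi y) = -g x y + eta x * eta y
  nondeg : ∀ x, (∀ y, g x y = 0) → x = 0
  D_g : ∀ z x y, N.der z (g x y) = g (N.D z x) y + g x (N.D z y)
  sasaki : ∀ x y, N.D x (phi y) - phi (N.D x y)
    = -(g x y) • xi - eta y • x + (2 * eta x * eta y) • xi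

namespace SasakiLike

variable {N : AffineConnection C X} (S : N.SasakiLike)

lemma g_xi (x : X) : S.g x S.xi = S.eta x := by
  have h := S.g_phi_phi x S.xi
  rw [S.phi_xi, map_zero, S.eta_xi] at h
  linear_combination h

lemma g_phi (x y : X) : S.g (S.phi x) y = S.g x (S.phi y) := by
  have h := S.g_phi_phi (S.phi x) y
  rw [S.phi_phi, S.eta_phi] at h
  have h' := S.g_xi (S.phi y)
  rw [S.g_symm, S.eta_phi] at h'
  simp only [map_add, map_neg, map_smul, LinearMap.add_apply, LinearMap.neg_apply,
    LinearMap.smul_apply, smul_eq_mul, h'] at h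
  linear_combination h

lemma g_phi_symm (x y : X) : S.g (S.phi x) y = S.g (S.phi y) x := by
  rw [g_phi, S.g_symm]

/-- The difference tensor `η(x) φ y + η(y) φ x - g(φ x, y) ξ` between the Levi-Civita connection
and the connection preserving the contact structure. -/
def diff : X →ₗ[C] X →ₗ[C] X :=
  LinearMap.mk₂ C (fun x y => S.eta x • S.phi y + S.eta y • S.phi x - S.g (S.phi x) y • S.xi)
    (fun x x' y => by simp only [map_add, LinearMap.add_apply]; module)
    (fun c x y => by simp only [map_smul, LinearMap.smul_apply, smul_eq_mul]; module)
    (fun x y y' => by simp only [map_add]; module)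
    (fun c x y => by simp only [map_smul, smul_eq_mul]; module)

lemma diff_apply (x y : X) :
    S.diff x y = S.eta x • S.phi y + S.eta y • S.phi x - S.g (S.phi x) y • S.xi := rfl

variable [Algebra ℝ C]

lemma D_xi (x : X) : N.D x S.xi = -S.phi x := by
  have h := S.sasaki x S.xi
  rw [S.phi_xi, map_zero, S.g_xi, S.eta_xi] at h
  have he : S.eta (N.D x S.xi) = 0 := by
    have h1 := S.D_g x S.xi S.xi
    rw [S.g_xi, S.eta_xi, der_one, S.g_symm S.xi, S.g_xi] at h1
    exact eq_zero_of_two_mul (by linear_combination -h1)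
  have h2 := congrArg S.phi h
  simp only [map_sub, map_add, map_smul, map_zero, S.phi_phi, S.phi_xi, he] at h2
  linear_combination (norm := module) h2

lemma D_eta (x y : X) : N.der x (S.eta y) = S.eta (N.D x y) - S.g (S.phi x) y := by
  rw [← S.g_xi, S.D_g, S.g_xi, S.D_xi, S.g_symm y, map_neg]
  simp [sub_eq_add_neg]

/-- The torsion-free connection preserving the contact structure. -/
def conn : AffineConnection C X :=
  N.addSymm S.diff fun x y => by rw [diff_apply, diff_apply, S.g_phi_symm x y, add_comm]

lemma conn_D (x y : X) : S.conn.D x y = N.D x y + S.diff x y := rfl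

lemma conn_der (x : X) (f : C) : S.conn.der x f = N.der x f := rfl

lemma conn_br (x y : X) : S.conn.br x y = N.br x y := by
  rw [br, conn_D, conn_D, br, diff_apply, diff_apply, S.g_phi_symm x y]
  abel

/-- The contact structure is parallel for `S.conn`. -/
def parallel : S.conn.ContactParallel where
  phi := S.phi
  xi := S.xi
  eta := S.eta
  P := S.g - LinearMap.mk₂ C (fun x y => S.eta x * S.eta y) (by simp [add_mul]) (by simp [mul_assoc])
    (by simp [mul_add]) (by intros; simp; ring)
  phi_phi := S.phi_phi
  phi_xi := S.phi_xi
  eta_phi := S.eta_phi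
  eta_xi := S.eta_xi
  P_symm x y := by simp [S.g_symm x y, mul_comm]
  P_xi y := by simp [S.g_symm S.xi, S.g_xi, S.eta_xi]
  P_phi x y := by simp [S.g_phi, S.eta_phi]
  nondeg x h := by
    apply S.nondeg
    intro y
    have h1 := h (S.phi y)
    simp only [LinearMap.sub_apply, LinearMap.mk₂_apply, S.eta_phi, mul_zero, sub_zero] at h1
    rw [S.g_phi, h1]
  D_xi x := by
    rw [conn_D, S.D_xi, diff_apply, S.phi_xi, S.eta_xi, S.g_xi, S.eta_phi]
    module
  D_phi x y := by
    have h := S.sasaki x y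
    rw [conn_D, conn_D, diff_apply, diff_apply]
    simp only [map_add, map_sub, map_smul, S.phi_phi, S.phi_xi, S.eta_phi, S.g_phi_phi]
    linear_combination (norm := module) h
  D_eta x y := by
    rw [conn_D, conn_der, S.D_eta, diff_apply]
    simp [S.eta_phi, S.eta_xi, sub_eq_add_neg]
  D_P z x y := by
    have h1 := S.g_phi_symm z x
    have h2 := S.g_phi_symm y x
    have h3 := S.g_phi_symm y z
    have h4 := S.g_phi z x
    have h5 := S.g_phi z y
    have h6 := S.g_symm x (S.phi y)
    have h7 := S.g_symm S.xi y
    rw [S.g_xi] at h7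
    have h8 := S.g_symm x (S.phi z)
    simp only [conn_D, conn_der, diff_apply, LinearMap.sub_apply, LinearMap.mk₂_apply, map_sub,
      map_add, map_smul, LinearMap.add_apply, LinearMap.smul_apply, smul_eq_mul, S.eta_phi,
      S.eta_xi, S.g_xi, S.D_g, der_mul, S.D_eta, h7, h6, h8]
    linear_combination -S.eta z * h2

lemma parallel_P (x y : X) : S.parallel.P x y = S.g x y - S.eta x * S.eta y := rfl

lemma parallel_F (x y : X) : S.parallel.F x y = S.g (S.phi x) y := by
  rw [ContactParallel.F, parallel_P]
  change _ - S.eta (S.phi x) * _ = _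
  rw [S.eta_phi, zero_mul, sub_zero]
  rfl

lemma diff_eq (x y : X) :
    S.diff x y = S.eta x • S.phi y + S.eta y • S.phi x - S.parallel.F x y • S.xi := by
  rw [diff_apply, parallel_F]

/-- In `∇ = D - diff` every ingredient of `diff` except `F` is `D`-parallel. The correction
therefore consists of the term from `DF = 2 η ⊗ P` and terms quadratic in `diff`. -/
lemma R_eq (x y z : X) : N.R x y z = S.conn.R x y z + (S.eta x * S.parallel.P y z) • S.xi
    - (S.eta y * S.parallel.P x z) • S.xi
    + S.eta z • (S.eta x • S.phi (S.phi y) - S.eta y • S.phi (S.phi x))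
    - S.parallel.F y z • S.phi x + S.parallel.F x z • S.phi y := by
  have hD : ∀ x y, N.D x y = S.conn.D x y - S.diff x y := fun x y => by
    rw [conn_D, add_sub_cancel_right]
  have e1 : ∀ x y, S.conn.D x (S.phi y) = S.phi (S.conn.D x y) := S.parallel.D_phi
  have e2 : ∀ x, S.conn.D x S.xi = 0 := S.parallel.D_xi
  have e3 : ∀ x y, S.conn.der x (S.eta y) = S.eta (S.conn.D x y) := S.parallel.D_eta
  have e4 : ∀ z x y, S.conn.der z (S.parallel.F x y) = S.parallel.F (S.conn.D z x) y
      + S.parallel.F x (S.conn.D z y) + 2 * S.eta z * S.parallel.P x y := S.parallel.D_F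
  have f4 : ∀ x, S.parallel.F x S.xi = 0 := S.parallel.F_xi_right
  have f5 : ∀ x y, S.parallel.F x (S.phi y) = -S.parallel.P x y := S.parallel.F_phi_right
  have f7 : S.parallel.P x y = S.parallel.P y x := S.parallel.P_symm x y
  rw [R, ← S.conn_br, R, br]
  simp only [hD, diff_eq, map_add, map_sub, map_smul, AddMonoidHom.sub_apply, S.conn.D_smul, e1, e2, e3, e4, f4,
    f5, f7, S.eta_phi, S.eta_xi, S.phi_xi]
  module

variable {ι : Type*} [Fintype ι]

lemma tr_R (T : TraceFrame C X ι) (hphi : T.tr S.phi = 0) (y z : X) : T.tr (fun x => N.R x y z)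
    = T.tr (fun x => S.conn.R x y z) + (T.tr id - T.chi) * (S.eta y * S.eta z) := by
  have h1 := T.tr_smulRight S.eta S.xi
  have h2 := T.tr_smulRight (S.parallel.P.flip z) S.xi
  have h3 := T.tr_smulRight S.eta (S.phi (S.phi y))
  have h4 := T.tr_smulRight (S.parallel.P.flip z ∘ₗ S.phi) (S.phi y)
  have h5 : S.parallel.P S.xi z = 0 := S.parallel.P_xi z
  have h6 : S.parallel.P (S.phi (S.phi y)) z = -S.parallel.P y z := S.parallel.F_phi y z
  have h7 : ∀ x, S.parallel.F x z = S.parallel.P (S.phi x) z := fun _ => rfl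
  simp only [TraceFrame.tr, S.R_eq, h7, LinearMap.flip_apply, LinearMap.comp_apply, S.eta_xi,
    S.eta_phi, h5, h6, id, map_smul, smul_eq_mul] at hphi h1 h2 h3 h4 ⊢
  simp only [map_add, map_sub, map_smul, smul_eq_mul, S.phi_phi, map_neg] at h3 ⊢
  calc _ = ∑ i, (T.th i (S.conn.R (T.E i) y z) + S.parallel.P y z * (S.eta (T.E i) * T.th i S.xi)
        - S.eta y * (S.parallel.P (T.E i) z * T.th i S.xi)
        + S.eta z * (S.eta (T.E i) * (-T.th i y + S.eta y * T.th i S.xi))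
        + S.eta y * S.eta z * T.th i (T.E i) - S.eta y * S.eta z * (S.eta (T.E i) * T.th i S.xi)
        - S.parallel.P (S.phi y) z * T.th i (S.phi (T.E i))
        + S.parallel.P (S.phi (T.E i)) z * T.th i (S.phi y)) :=
        Finset.sum_congr rfl fun i _ => by ring
    _ = _ := by
        simp only [Finset.sum_add_distrib, Finset.sum_sub_distrib, ← Finset.mul_sum]
        rw [h1, h2, h3, h4, hphi]
        ring

/-- The components of the soliton equation of a Sasaki-like structure. -/
structure Soliton where
  /-- the potential -/
  v : X
  /-- the Ricci form -/
  rho : X → X → C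
  /-- the coefficient of the metric -/
  lam : C
  /-- the coefficient of the associated metric -/
  mu : C
  /-- the coefficient of `η ⊗ η` -/
  nu : C
  /-- the value of `ρ(ξ, ξ)` -/
  m : C
  der_lam : ∀ x, N.der x lam = 0
  der_mu : ∀ x, N.der x mu = 0
  der_nu : ∀ x, N.der x nu = 0
  der_m : ∀ x, N.der x m = 0
  /-- `ρ` is the Ricci tensor -/
  rho_tr : ∀ f : C, (∀ T : TraceFrame C X ι, (∀ y z, T.chi * rho y z = T.tr (fun x => N.R x y z)) →
    T.tr S.phi = 0 → T.tr id = (m + 1) * T.chi → T.chi ^ 2 * f = 0) → f = 0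
  eqn : ∀ y z, N.der v (S.g y z) - S.g (N.br v y) z - S.g y (N.br v z)
    + 2 * (rho y z + lam * S.g y z + mu * (S.g y (S.phi z) + S.eta y * S.eta z)
      + nu * (S.eta y * S.eta z)) = 0

namespace Soliton

variable {S} (Q : S.Soliton (ι := ι))

lemma rho_xi (y : X) : Q.rho y S.xi = Q.m * S.eta y := by
  rw [← sub_eq_zero]
  -- Frames exist only locally, so identities for `ρ` are checked after multiplication by `χ²`. One
  -- `χ` comes from the trace, the other is needed in `der_tr`.
  refine Q.rho_tr _ fun T hT hphi hid => ?_
  have hR : ∀ x, S.conn.R x y S.xi = 0 := fun x => S.parallel.R_xi x y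
  have h := S.tr_R T hphi y S.xi
  rw [← hT, hid, S.eta_xi] at h
  simp only [hR, TraceFrame.tr, map_zero, Finset.sum_const_zero] at h
  linear_combination T.chi * h

/-- Up to the parallel term `m η ⊗ η`, `ρ` is the trace of the curvature of `D`, which is
`D_ξ`-invariant by `D_xi_R`; traces commute with `D_ξ` by `der_tr`. -/
lemma der_rho (y z : X) : S.conn.der S.xi (Q.rho y z)
    = Q.rho (S.conn.D S.xi y) z + Q.rho y (S.conn.D S.xi z) := by
  rw [← sub_eq_zero]
  refine Q.rho_tr _ fun T hT hphi hid => ?_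
  have hr : ∀ y z, T.chi * Q.rho y z
      = T.tr (S.conn.RHom y z) + Q.m * T.chi * (S.eta y * S.eta z) := by
    intro y z
    rw [hT, S.tr_R T hphi y z, hid]
    change _ = T.tr (fun x => S.conn.R x y z) + _
    ring
  have h0 := congrArg (S.conn.der S.xi) (hr y z)
  have h1 := hr (S.conn.D S.xi y) z
  have h2 := hr y (S.conn.D S.xi z)
  have h3 := TraceFrame.der_tr S.conn T S.xi (S.conn.RHom y z)
  have h4 : T.tr (fun e => S.conn.D S.xi (S.conn.RHom y z e) - S.conn.RHom y z (S.conn.D S.xi e))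
      = T.tr (S.conn.RHom (S.conn.D S.xi y) z) + T.tr (S.conn.RHom y (S.conn.D S.xi z)) := by
    have h : ∀ e, S.conn.D S.xi (S.conn.R e y z) = S.conn.R (S.conn.D S.xi e) y z
      + S.conn.R e (S.conn.D S.xi y) z + S.conn.R e y (S.conn.D S.xi z) :=
      fun e => S.parallel.D_xi_R e y z
    simp only [TraceFrame.tr, RHom, LinearMap.coe_mk, AddHom.coe_mk, ← Finset.sum_add_distrib,
      ← map_add]
    refine Finset.sum_congr rfl fun i _ => congrArg _ ?_
    rw [h]
    abel
  have e3 : ∀ x y, S.conn.der x (S.eta y) = S.eta (S.conn.D x y) := S.parallel.D_eta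
  have hm : S.conn.der S.xi Q.m = 0 := Q.der_m _
  simp only [map_add, der_mul, hm, e3] at h0
  rw [h4] at h3
  linear_combination T.chi * h0 + h3 - T.chi * h1 - T.chi * h2
    - S.conn.der S.xi T.chi * hr y z

/-- The soliton equation in terms of the connection preserving the contact structure. -/
def parallel : S.parallel.Soliton where
  v := Q.v
  rho := Q.rho
  lam := Q.lam
  mu := Q.mu
  kap := Q.lam + Q.mu + Q.nu
  m := Q.m
  der_lam := Q.der_lam
  der_mu := Q.der_mu
  der_kap x := by simp only [map_add, conn_der, Q.der_lam, Q.der_mu, Q.der_nu, add_zero]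
  der_m := Q.der_m
  rho_xi := Q.rho_xi
  der_rho := Q.der_rho
  eqn y z := by
    have h := Q.eqn y z
    have hF : S.parallel.F y z = S.g y (S.phi z) := by rw [parallel_F, g_phi]
    have hP : ∀ y z, S.g y z = S.parallel.P y z + S.eta y * S.eta z := fun y z => by
      rw [parallel_P, sub_add_cancel]
    have e3 : ∀ x y, N.der x (S.eta y) = S.eta (S.conn.D x y) := S.parallel.D_eta
    have e4 : N.der Q.v (S.parallel.P y z) = S.parallel.P (S.conn.D Q.v y) z
      + S.parallel.P y (S.conn.D Q.v z) - 2 * S.eta Q.v * S.parallel.F y z :=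
      S.parallel.D_P Q.v y z
    have hb : ∀ x y, N.br x y = S.conn.D x y - S.conn.D y x := fun x y => by
      rw [← conn_br, br]
    rw [← hF] at h
    simp only [hP, map_add, der_mul, e3, e4, hb, map_sub, LinearMap.sub_apply] at h
    change S.parallel.P (S.conn.D y Q.v) z + S.parallel.P y (S.conn.D z Q.v)
      + S.eta (S.conn.D y Q.v) * S.eta z + S.eta y * S.eta (S.conn.D z Q.v)
      - 2 * S.eta Q.v * S.parallel.F y z + 2 * (Q.rho y z + Q.lam * S.parallel.P y z
      + Q.mu * S.parallel.F y z + (Q.lam + Q.mu + Q.nu) * (S.eta y * S.eta z)) = 0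
    linear_combination h

lemma D_xi_v : N.D S.xi Q.v = S.conn.D S.xi Q.v - S.phi Q.v := by
  rw [conn_D, diff_apply, S.phi_xi, S.eta_xi]
  simp

/-- The two hypotheses are cancellation rules: `hF` expresses that `F` vanishes at no point, `hP`
that `P` vanishes at no point and that functions are real-valued. -/
theorem conclusion (hF : ∀ c : C, (∀ y z, c * S.g (S.phi y) z = 0) → c = 0)
    (hP : ∀ c d : C, (∀ y z, (c ^ 2 + d ^ 2) * (S.g y z - S.eta y * S.eta z) = 0) → d = 0) :
    Q.m + (Q.lam + Q.mu + Q.nu) = 0 ∧ N.br Q.v S.xi = 0 ∧ N.D S.xi Q.v = -S.phi Q.v := by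
  have hc : Q.m + (Q.lam + Q.mu + Q.nu) = 0 := hF _ fun y z => by
    rw [← parallel_F]
    exact Q.parallel.kap_mul_F y z
  have hd : ∀ x, S.eta (S.conn.D x Q.v) = 0 := fun x => hP _ _ fun y z =>
    Q.parallel.eta_D_sq_mul hc x y z
  have ha : S.conn.D S.xi Q.v = 0 := by
    apply S.parallel.eq_of_P_eq
    · intro z
      have h := Q.parallel.P_D_xi z
      have hd' : S.parallel.eta (S.conn.D z Q.parallel.v) = 0 := hd z
      have hc' : Q.parallel.m + Q.parallel.kap = 0 := hc
      rw [S.parallel.P_symm, hd', hc', neg_zero, zero_mul, sub_zero] at h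
      rw [map_zero]
      exact h
    · rw [map_zero]
      exact hd S.xi
  refine ⟨hc, ?_, by rw [D_xi_v, ha, zero_sub]⟩
  have h : S.conn.D Q.v S.xi = 0 := S.parallel.D_xi _
  rw [← conn_br, br, ha, h, sub_zero]

end Soliton

end SasakiLike
end AffineConnection

/-! ### Smooth functions and fields as an instance of the algebra. -/

noncomputable section

namespace BMetric

variable {n : ℕ} {M : Type*} [TopologicalSpace M] [ChartedSpace (Model n) M]
  [IsManifold (𝓡 (2 * n + 1)) ∞ M]

/-- The ring of smooth functions. -/
abbrev Fn (n : ℕ) (M : Type*) [TopologicalSpace M] [ChartedSpace (Model n) M] : Type _ :=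
  C^∞⟮𝓡 (2 * n + 1), M; 𝓘(ℝ, ℝ), ℝ⟯

/-- The smooth vector fields. -/
abbrev Fld (n : ℕ) (M : Type*) [TopologicalSpace M] [ChartedSpace (Model n) M]
    [IsManifold (𝓡 (2 * n + 1)) ∞ M] : Type _ :=
  Cₛ^∞⟮𝓡 (2 * n + 1); Model n, (TangentSpace (𝓡 (2 * n + 1)) : M → Type _)⟯

instance : SMul (Fn n M) (Fld n M) where
  smul f X := ⟨(f : M → ℝ) • (X : VF n M), f.contMDiff.smul_section X.contMDiff⟩

@[simp] lemma smul_apply (f : Fn n M) (X : Fld n M) (p : M) : (f • X) p = f p • X p := rfl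

lemma coe_smul (f : Fn n M) (X : Fld n M) : ⇑(f • X) = (f : M → ℝ) • (X : VF n M) := rfl

@[simp] lemma add_apply (X Y : Fld n M) (p : M) : (X + Y) p = X p + Y p := rfl

@[simp] lemma sub_apply (X Y : Fld n M) (p : M) : (X - Y) p = X p - Y p := rfl

@[simp] lemma neg_apply (X : Fld n M) (p : M) : (-X) p = -X p := rfl

@[simp] lemma zero_apply (p : M) : (0 : Fld n M) p = 0 := rfl

@[simp] lemma fn_add_apply (f h : Fn n M) (p : M) : (f + h) p = f p + h p := rfl

@[simp] lemma fn_mul_apply (f h : Fn n M) (p : M) : (f * h) p = f p * h p := rfl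

@[simp] lemma fn_one_apply (p : M) : (1 : Fn n M) p = 1 := rfl

instance : Module (Fn n M) (Fld n M) where
  one_smul X := by ext1 p; simp
  mul_smul f h X := by ext1 p; simp [mul_smul]
  smul_zero f := by ext1 p; simp
  smul_add f X Y := by ext1 p; simp
  add_smul f h X := by ext1 p; simp [add_smul]
  zero_smul X := by ext1 p; simp

lemma Fld.diffAt (X : Fld n M) (p : M) : DiffVFAt (X : VF n M) p := X.mdifferentiableAt

lemma Fn.diffAt (f : Fn n M) (p : M) : MDifferentiableAt (𝓡 (2 * n + 1)) 𝓘(ℝ, ℝ) f p :=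
  f.contMDiff.mdifferentiable (by simp) p

namespace AlmostContactBMetric

variable (S : AlmostContactBMetric n M)

/-- The action of `φ` on smooth vector fields. -/
def phiL : Fld n M →ₗ[Fn n M] Fld n M where
  toFun X := ⟨fun p => S.phi p (X p), S.smooth_phi.clm_bundle_apply X.contMDiff⟩
  map_add' X Y := by ext1 p; exact (S.phi p).map_add _ _
  map_smul' f X := by ext1 p; exact (S.phi p).map_smul _ _

/-- The smooth Reeb field. -/
def xiL : Fld n M := ⟨S.xi, S.smooth_xi⟩

/-- The action of `η` on smooth vector fields. -/
def etaL : Fld n M →ₗ[Fn n M] Fn n M where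
  toFun X := ⟨fun p => S.eta p (X p), by
    have h := S.smooth_eta.clm_bundle_apply (E₂ := fun _ : M => ℝ) X.contMDiff
    exact fun p => (contMDiffAt_section p).1 (h p)⟩
  map_add' X Y := by ext1 p; exact (S.eta p).map_add _ _
  map_smul' f X := by ext1 p; exact (S.eta p).map_smul _ _

/-- The action of `g` on smooth vector fields. -/
def gL : Fld n M →ₗ[Fn n M] Fld n M →ₗ[Fn n M] Fn n M :=
  LinearMap.mk₂ (Fn n M) (fun X Y => ⟨fun p => S.g p (X p) (Y p), by
    have h := S.smooth_g.clm_bundle_apply₂ (E₃ := fun _ : M => ℝ) X.contMDiff Y.contMDiff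
    exact fun p => (contMDiffAt_section p).1 (h p)⟩)
    (fun X X' Y => by ext1 p; exact (S.g p).map_add₂ _ _ _)
    (fun f X Y => by ext1 p; exact (S.g p).map_smul₂ _ _ _)
    (fun X Y Y' => by ext1 p; exact (S.g p (X p)).map_add _ _)
    (fun f X Y => by ext1 p; exact (S.g p (X p)).map_smul _ _)

@[simp] lemma xiL_apply (p : M) : S.xiL p = S.xi p := rfl
@[simp] lemma etaL_apply (X : Fld n M) (p : M) : S.etaL X p = S.eta p (X p) := rfl

end AlmostContactBMetric

variable {g : (p : M) → (Tan n p →L[ℝ] Tan n p →L[ℝ] ℝ)}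
  {nabla : CovariantDerivative (𝓡 (2 * n + 1)) (Model n)
      (TangentSpace (𝓡 (2 * n + 1)) : M → Type _)}

/-- The covariant derivative of a smooth vector field is a smooth section of `Hom(TM, TM)`. -/
lemma IsLeviCivita.contMDiff_nabla (h : IsLeviCivita g nabla) (Y : Fld n M) :
    ContMDiff (𝓡 (2 * n + 1)) ((𝓡 (2 * n + 1)).prod 𝓘(ℝ, Model n →L[ℝ] Model n)) ∞
    (fun p => (TotalSpace.mk' (Model n →L[ℝ] Model n) p (nabla Y p) :
      TotalSpace (Model n →L[ℝ] Model n) (fun p : M => Tan n p →L[ℝ] Tan n p))) :=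
  contMDiffOn_univ.1 (h.smooth.contMDiff.contMDiff (σ := Y) (contMDiffOn_univ.2 Y.contMDiff))

/-- `∇_X Y` as a smooth vector field. -/
def IsLeviCivita.cov (h : IsLeviCivita g nabla) (X Y : Fld n M) : Fld n M :=
  ⟨covD nabla X Y, (h.contMDiff_nabla Y).clm_bundle_apply X.contMDiff⟩

@[simp] lemma IsLeviCivita.cov_apply (h : IsLeviCivita g nabla) (X Y : Fld n M) (p : M) :
    h.cov X Y p = nabla Y p (X p) := rfl

lemma nabla_smul (f : Fn n M) (X Y : Fld n M) (p : M) :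
    nabla (f • Y : Fld n M) p (X p) = f p • nabla Y p (X p)
      + mvfderiv (𝓡 (2 * n + 1)) f p (X p) • Y p := by
  rw [coe_smul, nabla.isCovariantDerivativeOnUniv.leibniz (Y.diffAt p) (f.diffAt p)]
  rfl

/-- The derivative of a smooth function along a smooth vector field. -/
def IsLeviCivita.lie (S : AlmostContactBMetric n M) (h : IsLeviCivita S.g nabla) (X : Fld n M)
    (f : Fn n M) : Fn n M :=
  ⟨dirDeriv X f, by
    -- Smoothness of `X f` is read off from the Leibniz rule: `X f = η(∇_X (f ξ) - f ∇_X ξ)`.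
    have e : dirDeriv (X : VF n M) f
        = S.etaL (h.cov X (f • S.xiL) - f • h.cov X S.xiL) := by
      ext p
      simp [nabla_smul, S.eta_xi, dirDeriv]
    rw [e]
    exact ContMDiffMap.contMDiff _⟩

lemma IsLeviCivita.br_apply (h : IsLeviCivita g nabla) (X Y : Fld n M) :
    ⇑(h.cov X Y - h.cov Y X) = mlieBracket (𝓡 (2 * n + 1)) (X : VF n M) Y := by
  ext1 p
  exact h.torsion_free X Y p (X.diffAt p) (Y.diffAt p)

lemma IsLeviCivita.jacobi_identity (h : IsLeviCivita g nabla) (X Y Z : Fld n M) :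
    h.cov X (h.cov Y Z - h.cov Z Y) - h.cov (h.cov Y Z - h.cov Z Y) X
      = (h.cov (h.cov X Y - h.cov Y X) Z - h.cov Z (h.cov X Y - h.cov Y X))
        + (h.cov Y (h.cov X Z - h.cov Z X) - h.cov (h.cov X Z - h.cov Z X) Y) := by
  apply ContMDiffSection.coe_injective
  rw [ContMDiffSection.coe_add, h.br_apply, h.br_apply, h.br_apply, h.br_apply, h.br_apply,
    h.br_apply]
  have h2 : minSmoothness ℝ 2 ≤ (∞ : WithTop ℕ∞) := by
    rw [minSmoothness_of_isRCLikeNormedField]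
    exact WithTop.coe_le_coe.2 le_top
  have h3 : minSmoothness ℝ 3 ≤ (∞ : WithTop ℕ∞) := by
    rw [minSmoothness_of_isRCLikeNormedField]
    exact WithTop.coe_le_coe.2 le_top
  have : IsManifold (𝓡 (2 * n + 1)) (minSmoothness ℝ 3) M := IsManifold.of_le h3
  exact leibniz_identity_mlieBracket (X.contMDiff.of_le h2) (Y.contMDiff.of_le h2)
    (Z.contMDiff.of_le h2)

/-- The derivative of smooth functions along smooth vector fields, as a linear map. -/
def IsLeviCivita.lieL (S : AlmostContactBMetric n M) (h : IsLeviCivita S.g nabla) :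
    Fld n M →ₗ[Fn n M] (Fn n M →+ Fn n M) where
  toFun X :=
    { toFun := h.lie S X
      map_zero' := by
        ext p
        change mvfderiv _ (fun _ : M => (0 : ℝ)) p (X p) = 0
        rw [mvfderiv_const]; rfl
      map_add' := fun f f' => by
        ext p
        change mvfderiv _ (⇑f + ⇑f') p (X p) = _
        rw [mvfderiv_add (f.diffAt p) (f'.diffAt p)]; rfl }
  map_add' X Y := by ext f p; exact (mvfderiv _ f p).map_add _ _
  map_smul' c X := by ext f p; exact (mvfderiv _ f p).map_smul _ _

/-- The covariant derivative of smooth vector fields, as a linear map. -/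
def IsLeviCivita.covL (h : IsLeviCivita g nabla) : Fld n M →ₗ[Fn n M] (Fld n M →+ Fld n M) where
  toFun X :=
    { toFun := h.cov X
      map_zero' := by
        ext1 p
        rw [h.cov_apply, ContMDiffSection.coe_zero, nabla.zero]; rfl
      map_add' := fun Y Z => by
        ext1 p
        rw [h.cov_apply, ContMDiffSection.coe_add,
          nabla.isCovariantDerivativeOnUniv.add (Y.diffAt p) (Z.diffAt p)]
        rfl }
  map_add' X Y := by ext1 Z; ext1 p; exact (nabla Z p).map_add _ _
  map_smul' c X := by ext1 Z; ext1 p; exact (nabla Z p).map_smul _ _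

lemma IsLeviCivita.lie_mul (S : AlmostContactBMetric n M) (h : IsLeviCivita S.g nabla)
    (X : Fld n M) (f f' : Fn n M) :
    h.lie S X (f * f') = h.lie S X f * f' + f * h.lie S X f' := by
  ext p
  change mvfderiv _ (⇑f * ⇑f') p (X p) = mvfderiv _ f p (X p) * f' p + f p * mvfderiv _ f' p (X p)
  rw [mvfderiv_mul (f.diffAt p) (f'.diffAt p)]
  change f p * mvfderiv _ f' p (X p) + f' p * mvfderiv _ f p (X p) = _
  ring

lemma IsLeviCivita.cov_smul (S : AlmostContactBMetric n M) (h : IsLeviCivita S.g nabla)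
    (X : Fld n M) (f : Fn n M) (Y : Fld n M) :
    h.cov X (f • Y) = h.lie S X f • Y + f • h.cov X Y := by
  ext1 p
  exact (nabla_smul f X Y p).trans (add_comm _ _)

/-- The Levi-Civita connection on smooth vector fields. -/
def IsLeviCivita.conn (S : AlmostContactBMetric n M) (h : IsLeviCivita S.g nabla) :
    AffineConnection (Fn n M) (Fld n M) where
  der := h.lieL S
  D := h.covL
  der_mul := h.lie_mul S
  D_smul := h.cov_smul S
  jacobi := h.jacobi_identity

lemma IsLeviCivita.conn_br (S : AlmostContactBMetric n M)
    (h : IsLeviCivita S.g nabla) (X Y : Fld n M) :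
    ⇑((h.conn S).br X Y) = mlieBracket (𝓡 (2 * n + 1)) (X : VF n M) Y := h.br_apply X Y

end BMetric

/-! ### Cut-off local frames and pointwise traces. -/

namespace BMetric

variable {n : ℕ} {M : Type*} [TopologicalSpace M] [ChartedSpace (Model n) M]
  [IsManifold (𝓡 (2 * n + 1)) ∞ M]

lemma sum_apply {ι : Type*} (s : Finset ι) (X : ι → Fld n M) (p : M) :
    (∑ i ∈ s, X i) p = ∑ i ∈ s, X i p := by
  rw [← ContMDiffSection.coeAddHom_apply, map_sum, Finset.sum_apply]
  rfl

lemma fn_sum_apply {ι : Type*} (s : Finset ι) (f : ι → Fn n M) (p : M) :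
    (∑ i ∈ s, f i) p = ∑ i ∈ s, f i p := by
  rw [← ContMDiffMap.coeFnAddMonoidHom_apply, map_sum, Finset.sum_apply]
  rfl

instance (p : M) : Module.Finite ℝ (Tan n p) := Module.Finite.of_basis (tanBasis p)

section Frame

variable [T2Space M] (q : M)

/-- The local frame of vector fields given by the preferred chart at `q`. -/
def chartFrame (i : Fin (2 * n + 1)) : VF n M :=
  (trivializationAt (Model n) (TangentSpace (𝓡 (2 * n + 1)) : M → Type _) q).localFrame
    (EuclideanSpace.basisFun (Fin (2 * n + 1)) ℝ).toBasis i

/-- The coframe of `chartFrame`. -/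
def chartCoframe (i : Fin (2 * n + 1)) (p : M) : Tan n p →ₗ[ℝ] ℝ :=
  (trivializationAt (Model n) (TangentSpace (𝓡 (2 * n + 1)) : M → Type _) q).localFrameCoeff
    (𝓡 (2 * n + 1)) (EuclideanSpace.basisFun (Fin (2 * n + 1)) ℝ).toBasis i p

lemma tsupport_bump_subset (f : SmoothBumpFunction (𝓡 (2 * n + 1)) q) :
    tsupport f ⊆
      (trivializationAt (Model n) (TangentSpace (𝓡 (2 * n + 1)) : M → Type _) q).baseSet := by
  rw [TangentBundle.trivializationAt_baseSet]
  exact f.tsupport_subset_chartAt_source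

lemma contMDiff_bump_smul_chartFrame (f : SmoothBumpFunction (𝓡 (2 * n + 1)) q)
    (i : Fin (2 * n + 1)) : SmoothVF ((f : M → ℝ) • chartFrame q i) :=
  ContMDiffOn.smul_section_of_tsupport f.contMDiff.contMDiffOn
    (trivializationAt (Model n) (TangentSpace (𝓡 (2 * n + 1)) : M → Type _) q).open_baseSet
    (tsupport_bump_subset q f)
    (Trivialization.contMDiffOn_localFrame_baseSet ∞ _ _ i)

lemma contMDiff_bump_mul_chartCoframe (f : SmoothBumpFunction (𝓡 (2 * n + 1)) q)
    (i : Fin (2 * n + 1)) (X : Fld n M) :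
    ContMDiff (𝓡 (2 * n + 1)) 𝓘(ℝ, ℝ) ∞ (fun p => f p * chartCoframe q i p (X p)) := by
  refine contMDiff_of_tsupport fun p hp => ?_
  have hp' : p ∈ tsupport f := closure_mono (fun x hx => left_ne_zero_of_mul hx) hp
  exact f.contMDiff.contMDiffAt.mul
    (contMDiffAt_localFrameCoeff _ (tsupport_bump_subset q f hp') X.contMDiff.contMDiffAt i)

/-- A frame of smooth vector fields near `q`, cut off outside a neighbourhood of `q`. -/
def cutoffFrame (f : SmoothBumpFunction (𝓡 (2 * n + 1)) q) :
    AffineConnection.TraceFrame (Fn n M) (Fld n M) (Fin (2 * n + 1)) where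
  -- Frame and coframe are each multiplied by the bump function, so their contraction carries its
  -- square.
  chi := ⟨f * f, f.contMDiff.mul f.contMDiff⟩
  E i := ⟨_, contMDiff_bump_smul_chartFrame q f i⟩
  th i :=
    { toFun := fun X => ⟨_, contMDiff_bump_mul_chartCoframe q f i X⟩
      map_add' := fun X Y => by
        ext p
        change f p * chartCoframe q i p (X p + Y p)
          = f p * chartCoframe q i p (X p) + f p * chartCoframe q i p (Y p)
        rw [map_add, mul_add]
      map_smul' := fun c X => by
        ext p
        change f p * chartCoframe q i p (c p • X p) = c p * (f p * chartCoframe q i p (X p))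
        rw [map_smul, smul_eq_mul, mul_left_comm] }
  expand X := by
    ext1 p
    rw [sum_apply]
    change ∑ i, (f p * chartCoframe q i p (X p)) • f p • chartFrame q i p = (f p * f p) • X p
    by_cases hp : p ∈ tsupport f
    · have h := Trivialization.eq_sum_localFrameCoeff_smul (I := 𝓡 (2 * n + 1))
        (b := (EuclideanSpace.basisFun (Fin (2 * n + 1)) ℝ).toBasis) (s := X)
        (tsupport_bump_subset q f hp)
      conv_rhs => rw [h]
      rw [Finset.smul_sum]
      refine Finset.sum_congr rfl fun i _ => ?_
      rw [smul_smul, smul_smul]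
      change (f p * chartCoframe q i p (X p) * f p) • _ = (_ * _) • chartFrame q i p
      rw [mul_right_comm]
      rfl
    · rw [image_eq_zero_of_notMem_tsupport hp]
      simp

/-- Every tangent vector extends to a smooth vector field. -/
lemma exists_fld (x : Tan n q) : ∃ X : Fld n M, X q = x := by
  obtain ⟨f⟩ : Nonempty (SmoothBumpFunction (𝓡 (2 * n + 1)) q) := inferInstance
  refine ⟨∑ i, algebraMap ℝ (Fn n M) (chartCoframe q i q x) • (cutoffFrame q f).E i, ?_⟩
  rw [sum_apply]
  change ∑ i, chartCoframe q i q x • f q • chartFrame q i q = x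
  have h := Trivialization.eq_sum_localFrameCoeff_smul (I := 𝓡 (2 * n + 1))
    (b := (EuclideanSpace.basisFun (Fin (2 * n + 1)) ℝ).toBasis)
    (s := FiberBundle.extend (Model n) x)
    (FiberBundle.mem_baseSet_trivializationAt' (F := Model n)
      (E := (TangentSpace (𝓡 (2 * n + 1)) : M → Type _)) q)
  rw [FiberBundle.extend_apply_self] at h
  simp only [f.eq_one, one_smul]
  exact h.symm

/-- There are frames of vector fields, cut off outside a neighbourhood of `q`, which compute traces
of endomorphisms. -/
lemma exists_traceFrame : ∃ T : AffineConnection.TraceFrame (Fn n M) (Fld n M) (Fin (2 * n + 1)),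
    T.chi q = 1 ∧ ∀ (p : M) (L : Tan n p →ₗ[ℝ] Tan n p) (L' : Fld n M → Fld n M),
      (∀ X, L' X p = L (X p)) → T.tr L' p = T.chi p * LinearMap.trace ℝ (Tan n p) L := by
  obtain ⟨f⟩ : Nonempty (SmoothBumpFunction (𝓡 (2 * n + 1)) q) := inferInstance
  refine ⟨cutoffFrame q f, ?_, fun p L L' h => ?_⟩
  · change f q * f q = 1
    rw [f.eq_one, one_mul]
  set T := cutoffFrame q f with hT
  let al (i) : Tan n p →ₗ[ℝ] ℝ := f p • chartCoframe q i p
  have h1 (i) (X : Fld n M) : T.th i X p = al i (X p) := rfl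
  have h2 (x : Tan n p) : ∑ i, al i x • T.E i p = T.chi p • x := by
    obtain ⟨X, rfl⟩ := exists_fld p x
    have h3 := congrArg (fun Y : Fld n M => Y p) (T.expand X)
    simp only [smul_apply] at h3
    rw [← h3, sum_apply]
    rfl
  -- `χ L` is a sum of rank-one operators `θ^i ⊗ L E_i`, whose traces are `θ^i (L E_i)`.
  have h4 : T.chi p • L = ∑ i, (al i).smulRight (L (T.E i p)) := by
    ext1 x
    rw [LinearMap.smul_apply, ← map_smul, ← h2, map_sum, LinearMap.sum_apply]
    exact Finset.sum_congr rfl fun i _ => map_smul _ _ _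
  have h5 := congrArg (LinearMap.trace ℝ (Tan n p)) h4
  rw [map_smul, map_sum, smul_eq_mul] at h5
  have h6 (i) := LinearMap.trace_smulRight (al i) (L (T.E i p))
  refine Eq.trans ?_ h5.symm
  rw [AffineConnection.TraceFrame.tr, fn_sum_apply]
  exact Finset.sum_congr rfl fun i _ => 
    ((h1 i _).trans (by rw [h])).trans (h6 i).symm

end Frame

lemma _root_.Complex.re_eq_zero_of_pow_three_eq_neg {z : ℂ} (h : z ^ 3 + z = 0) : z.re = 0 := by
  have h1 : z * (z ^ 2 + 1) = 0 := by linear_combination h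
  rcases mul_eq_zero.1 h1 with rfl | h2
  · rfl
  have hr := congrArg Complex.re h2
  have hi := congrArg Complex.im h2
  simp only [sq, Complex.add_re, Complex.mul_re, Complex.one_re, Complex.zero_re, Complex.add_im,
    Complex.mul_im, Complex.one_im, Complex.zero_im] at hr hi
  by_contra h3
  have h4 : z.im = 0 := by
    have : z.re * z.im = 0 := by linarith
    exact (mul_eq_zero.1 this).resolve_left h3
  rw [h4] at hr
  nlinarith [sq_nonneg z.re]

/-- An endomorphism `f` with `f³ = -f` of a real vector space is trace-free. -/
lemma trace_eq_zero_of_pow_three {V : Type*} [AddCommGroup V] [Module ℝ V]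
    {ι : Type*} [Fintype ι] [DecidableEq ι] (b : Module.Basis ι ℝ V) (f : V →ₗ[ℝ] V)
    (hf : f ^ 3 + f = 0) : LinearMap.trace ℝ V f = 0 := by
  rw [LinearMap.trace_eq_matrix_trace ℝ b]
  set A := LinearMap.toMatrixAlgEquiv b f with hA
  change A.trace = 0
  have hA3 : A ^ 3 + A = 0 := by rw [hA, ← map_pow, ← map_add, hf, map_zero]
  -- Over `ℂ` the trace is the sum of the eigenvalues, which are roots of `z³ + z` and so purely
  -- imaginary; the trace itself is real.
  set B : Matrix ι ι ℂ := Complex.ofRealHom.mapMatrix A with hB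
  have hB3 : B ^ 3 + B = 0 := by rw [hB, ← map_pow, ← map_add, hA3, map_zero]
  have hre : B.trace.re = 0 := by
    rw [Matrix.trace_eq_sum_roots_charpoly]
    change Complex.reAddGroupHom _ = 0
    rw [map_multiset_sum]
    refine Multiset.sum_eq_zero fun x hx => ?_
    obtain ⟨z, hz, rfl⟩ := Multiset.mem_map.1 hx
    refine Complex.re_eq_zero_of_pow_three_eq_neg ?_
    have h1 : z ∈ spectrum ℂ B :=
      Matrix.mem_spectrum_iff_isRoot_charpoly.2 (Polynomial.isRoot_of_mem_roots hz)
    have h2 := spectrum.subset_polynomial_aeval B (Polynomial.X ^ 3 + Polynomial.X)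
      (Set.mem_image_of_mem _ h1)
    have : Nontrivial (Matrix ι ι ℂ) := by
      by_contra hn
      rw [not_nontrivial_iff_subsingleton] at hn
      rw [spectrum.of_subsingleton] at h1
      exact h1
    simpa [hB3] using h2
  have h5 : B.trace = (A.trace : ℂ) := by
    simp [B, Matrix.trace]
  rw [h5] at hre
  simpa using hre

end BMetric

/-! ### Tensoriality of curvature, the Ricci trace, and the Sasaki-like instance. -/

namespace BMetric

variable {n : ℕ} {M : Type*} [TopologicalSpace M] [ChartedSpace (Model n) M]
  [IsManifold (𝓡 (2 * n + 1)) ∞ M]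

variable {nabla : CovariantDerivative (𝓡 (2 * n + 1)) (Model n)
      (TangentSpace (𝓡 (2 * n + 1)) : M → Type _)}

lemma IsLeviCivita.diffAt_covD {g : (p : M) → (Tan n p →L[ℝ] Tan n p →L[ℝ] ℝ)}
    (h : IsLeviCivita g nabla) (X : VF n M) (Z : Fld n M) {p : M}
    (hX : DiffVFAt X p) : DiffVFAt (covD nabla X Z) p :=
  MDifferentiableAt.clm_bundle_apply
    ((h.contMDiff_nabla Z).mdifferentiable (by simp) p) hX

lemma covD_add_left (X X' Z : VF n M) :
    covD nabla (X + X') Z = covD nabla X Z + covD nabla X' Z := by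
  ext1 p; exact (nabla Z p).map_add _ _

lemma covD_smul_left (f : M → ℝ) (X Z : VF n M) :
    covD nabla (f • X) Z = f • covD nabla X Z := by
  ext1 p; exact (nabla Z p).map_smul _ _

/-- The curvature is tensorial in its first argument. -/
lemma IsLeviCivita.tensorialAt_curvature {g : (p : M) → (Tan n p →L[ℝ] Tan n p →L[ℝ] ℝ)}
    (h : IsLeviCivita g nabla) (Y Z : Fld n M) (p : M) :
    TensorialAt (𝓡 (2 * n + 1)) (Model n) (fun X : VF n M => curvature nabla X Y Z p) p where
  smul {f X} hf hX := by
    have h1 : covD nabla Y (covD nabla (f • X) Z) p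
        = f p • covD nabla Y (covD nabla X Z) p
          + mvfderiv (𝓡 (2 * n + 1)) f p (Y p) • covD nabla X Z p := by
      rw [covD_smul_left]
      change nabla (f • covD nabla X Z) p (Y p) = _
      rw [nabla.isCovariantDerivativeOnUniv.leibniz (h.diffAt_covD X Z hX) hf]
      rfl
    have h2 : covD nabla (mlieBracket (𝓡 (2 * n + 1)) (f • X) Y) Z p
        = -mvfderiv (𝓡 (2 * n + 1)) f p (Y p) • covD nabla X Z p
          + f p • covD nabla (mlieBracket (𝓡 (2 * n + 1)) X Y) Z p := by
      change nabla Z p _ = _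
      rw [mlieBracket_smul_left hf hX, map_add, (nabla Z p).map_smul, (nabla Z p).map_smul]
      rfl
    change covD nabla (f • X) (covD nabla Y Z) p - covD nabla Y (covD nabla (f • X) Z) p
      - covD nabla (mlieBracket (𝓡 (2 * n + 1)) (f • X) Y) Z p
      = f p • (covD nabla X (covD nabla Y Z) p - covD nabla Y (covD nabla X Z) p
        - covD nabla (mlieBracket (𝓡 (2 * n + 1)) X Y) Z p)
    rw [h1, h2, covD_smul_left]
    change f p • covD nabla X (covD nabla Y Z) p - _ - _ = _
    module
  add {X X'} hX hX' := by
    have h1 : covD nabla Y (covD nabla (X + X') Z) p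
        = covD nabla Y (covD nabla X Z) p + covD nabla Y (covD nabla X' Z) p := by
      rw [covD_add_left]
      change nabla (covD nabla X Z + covD nabla X' Z) p (Y p) = _
      rw [nabla.isCovariantDerivativeOnUniv.add (h.diffAt_covD X Z hX) (h.diffAt_covD X' Z hX')]
      rfl
    have h2 : covD nabla (mlieBracket (𝓡 (2 * n + 1)) (X + X') Y) Z p
        = covD nabla (mlieBracket (𝓡 (2 * n + 1)) X Y) Z p
          + covD nabla (mlieBracket (𝓡 (2 * n + 1)) X' Y) Z p := by
      change nabla Z p _ = _
      rw [mlieBracket_add_left hX hX', map_add]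
      rfl
    change covD nabla (X + X') (covD nabla Y Z) p - covD nabla Y (covD nabla (X + X') Z) p
      - covD nabla (mlieBracket (𝓡 (2 * n + 1)) (X + X') Y) Z p
      = (covD nabla X (covD nabla Y Z) p - covD nabla Y (covD nabla X Z) p
        - covD nabla (mlieBracket (𝓡 (2 * n + 1)) X Y) Z p)
        + (covD nabla X' (covD nabla Y Z) p - covD nabla Y (covD nabla X' Z) p
        - covD nabla (mlieBracket (𝓡 (2 * n + 1)) X' Y) Z p)
    rw [h1, h2, covD_add_left]
    change covD nabla X (covD nabla Y Z) p + covD nabla X' (covD nabla Y Z) p - _ - _ = _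
    module

variable {S : AlmostContactBMetric n M} (h : IsLeviCivita S.g nabla)

lemma IsLeviCivita.conn_R_apply (X Y Z : Fld n M) :
    ⇑((h.conn S).R X Y Z) = curvature nabla X Y Z := by
  have : ⇑((h.conn S).D ((h.conn S).br X Y) Z)
      = covD nabla (mlieBracket (𝓡 (2 * n + 1)) (X : VF n M) Y) Z := by
    rw [← h.conn_br S]; rfl
  rw [AffineConnection.R, ContMDiffSection.coe_sub, this]
  rfl

/-- The curvature endomorphism `x ↦ R(x, Y) Z` of a tangent space. -/
def IsLeviCivita.curvatureHom (Y Z : Fld n M) (p : M) : Tan n p →ₗ[ℝ] Tan n p :=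
  (TensorialAt.mkHom (fun X : VF n M => curvature nabla X Y Z p) p
    (h.tensorialAt_curvature Y Z p)).toLinearMap

lemma IsLeviCivita.curvatureHom_apply (X Y Z : Fld n M) (p : M) :
    h.curvatureHom Y Z p (X p) = (h.conn S).R X Y Z p := by
  rw [h.conn_R_apply]
  exact TensorialAt.mkHom_apply (h.tensorialAt_curvature Y Z p) (X.diffAt p)

/-- The fields in `ricci` are smooth only near `p`. Tensoriality identifies the sum with an honest
trace, which the cut-off frames can also compute. -/
lemma IsLeviCivita.ricci_eq_trace (Y Z : Fld n M) (p : M) :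
    ricci nabla Y Z p = LinearMap.trace ℝ (Tan n p) (h.curvatureHom Y Z p) := by
  rw [LinearMap.trace_eq_matrix_trace ℝ (tanBasis p)]
  simp only [Matrix.trace, Matrix.diag, LinearMap.toMatrix_apply, ricci]
  rfl

namespace AlmostContactBMetric

variable (S)

lemma nondegenerate (p : M) {x : Tan n p} (hx : ∀ y, S.g p x y = 0) : x = 0 := by
  obtain ⟨b, h1, h2, h3⟩ := S.g_signature p
  have key (i) : b.repr x i * S.g p (b i) (b i) = 0 := by
    rw [← hx (b i)]
    conv_rhs => rw [← b.sum_repr x]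
    rw [map_sum, _root_.sum_apply, Finset.sum_eq_single i]
    · rw [map_smul]; rfl
    · intro j _ hj
      rw [map_smul, _root_.smul_apply, h3 j i hj, smul_zero]
    · intro hi; exact absurd (Finset.mem_univ i) hi
  apply b.ext_elem
  intro i
  rw [map_zero, Finsupp.zero_apply]
  have := key i
  rcases i with i | i
  · rwa [h1, mul_one] at this
  · rw [h2] at this; linarith

lemma trace_phi (p : M) : LinearMap.trace ℝ (Tan n p) (S.phi p) = 0 := by
  refine trace_eq_zero_of_pow_three (tanBasis p) _ ?_
  ext1 x
  change S.phi p (S.phi p (S.phi p x)) + S.phi p x = 0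
  rw [S.phi_phi, S.eta_phi]
  module

/-- For `n ≥ 1` there are non-zero vectors in the kernel of `η`. -/
lemma exists_horizontal (hn : 1 ≤ n) (p : M) : ∃ x : Tan n p, x ≠ 0 ∧ S.eta p x = 0 := by
  have h1 := LinearMap.finrank_range_add_finrank_ker (S.eta p).toLinearMap
  have h2 : Module.finrank ℝ (Tan n p) = 2 * n + 1 := by
    rw [Module.finrank_eq_card_basis (tanBasis p), Fintype.card_fin]
  have h3 := Submodule.finrank_le (LinearMap.range (S.eta p).toLinearMap)
  rw [Module.finrank_self] at h3
  have h4 : 0 < Module.finrank ℝ (LinearMap.ker (S.eta p).toLinearMap) := by omega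
  obtain ⟨⟨x, hx⟩, hx0⟩ := Module.finrank_pos_iff_exists_ne_zero.1 h4
  exact ⟨x, fun h => hx0 (Subtype.ext h), hx⟩

variable [T2Space M]

lemma exists_g_phi_ne_zero (hn : 1 ≤ n) (p : M) :
    ∃ Y Z : Fld n M, S.g p (S.phi p (Y p)) (Z p) ≠ 0 := by
  obtain ⟨x, hx, hx'⟩ := S.exists_horizontal hn p
  by_contra! hc
  have h0 : S.phi p x = 0 := by
    refine S.nondegenerate p fun y => ?_
    obtain ⟨X, rfl⟩ := exists_fld p x
    obtain ⟨Y, rfl⟩ := exists_fld p y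
    exact hc X Y
  have h1 := S.phi_phi p x
  rw [h0, map_zero, hx', zero_smul, add_zero] at h1
  exact hx (neg_eq_zero.1 h1.symm)

lemma exists_g_sub_ne_zero (hn : 1 ≤ n) (p : M) :
    ∃ Y Z : Fld n M, S.g p (Y p) (Z p) - S.eta p (Y p) * S.eta p (Z p) ≠ 0 := by
  obtain ⟨x, hx, hx'⟩ := S.exists_horizontal hn p
  by_contra! hc
  refine hx (S.nondegenerate p fun y => ?_)
  obtain ⟨X, rfl⟩ := exists_fld p x
  obtain ⟨Y, rfl⟩ := exists_fld p y
  simpa [hx'] using hc X Y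

end AlmostContactBMetric

variable [T2Space M]

lemma fn_two_apply (p : M) : (2 : Fn n M) p = 2 := by
  have h := congrArg (fun f : Fn n M => f p) (one_add_one_eq_two (R := Fn n M))
  exact h.symm.trans (one_add_one_eq_two (R := ℝ))

/-- The algebraic Sasaki-like structure on the smooth vector fields. -/
def IsSasakiLike.alg (hS : IsSasakiLike S nabla) : (h.conn S).SasakiLike where
  phi := S.phiL
  xi := S.xiL
  eta := S.etaL
  g := S.gL
  phi_phi X := by ext1 p; exact S.phi_phi p (X p)
  phi_xi := by ext1 p; exact S.phi_xi p
  eta_phi X := by ext p; exact S.eta_phi p (X p)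
  eta_xi := by ext p; exact S.eta_xi p
  g_symm X Y := by ext p; exact S.g_symm p _ _
  g_phi_phi X Y := by ext p; exact S.g_phi_phi p _ _
  nondeg X hX := by
    ext1 p
    refine S.nondegenerate p fun y => ?_
    obtain ⟨Y, rfl⟩ := exists_fld p y
    exact DFunLike.congr_fun (hX Y) p
  D_g Z X Y := by ext p; exact h.metric Z X Y p (X.diffAt p) (Y.diffAt p)
  sasaki X Y := by 
    ext1 p
    refine (hS X Y X.contMDiff Y.contMDiff p).trans ?_
    rw [← fn_two_apply (n := n) p]
    rfl

end BMetric

/-! ### The soliton instance and the theorem. -/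

namespace BMetric

variable {n : ℕ} {M : Type*} [TopologicalSpace M] [ChartedSpace (Model n) M]
  [IsManifold (𝓡 (2 * n + 1)) ∞ M]
  {nabla : CovariantDerivative (𝓡 (2 * n + 1)) (Model n)
    (TangentSpace (𝓡 (2 * n + 1)) : M → Type _)}
  {S : AlmostContactBMetric n M} (h : IsLeviCivita S.g nabla)

lemma algebraMap_apply (c : ℝ) (p : M) : algebraMap ℝ (Fn n M) c p = c := rfl

lemma IsLeviCivita.der_algebraMap (X : Fld n M) (c : ℝ) :
    (h.conn S).der X (algebraMap ℝ (Fn n M) c) = 0 := by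
  ext p
  change mvfderiv _ (fun _ : M => c) p (X p) = 0
  rw [mvfderiv_const]
  rfl

/-- The Lie derivative of the metric along a smooth vector field. -/
def IsLeviCivita.lieMetric (V Y Z : Fld n M) : Fn n M :=
  (h.conn S).der V (S.gL Y Z) - S.gL ((h.conn S).br V Y) Z - S.gL Y ((h.conn S).br V Z)

lemma IsLeviCivita.lieMetric_apply (V Y Z : Fld n M) (p : M) :
    h.lieMetric V Y Z p = lieDerivMetric S.g V Y Z p := by
  rw [lieDerivMetric, ← h.conn_br, ← h.conn_br]
  rfl

/-- The Ricci tensor of a Ricci-like soliton, as a smooth function. -/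
def IsLeviCivita.solitonRho (V : Fld n M) (lam mu nu : ℝ) (Y Z : Fld n M) : Fn n M :=
  -- Solving the soliton equation for `ρ` makes its smoothness automatic.
  -(algebraMap ℝ (Fn n M) (1 / 2) * h.lieMetric V Y Z
    + algebraMap ℝ (Fn n M) lam * S.gL Y Z
    + algebraMap ℝ (Fn n M) mu * (S.gL Y (S.phiL Z) + S.etaL Y * S.etaL Z)
    + algebraMap ℝ (Fn n M) nu * (S.etaL Y * S.etaL Z))

lemma IsLeviCivita.solitonRho_apply (V : Fld n M) (lam mu nu : ℝ)
    (hsol : IsRicciLikeSoliton S nabla V lam mu nu) (Y Z : Fld n M) (p : M) :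
    h.solitonRho V lam mu nu Y Z p = ricci nabla Y Z p := by
  have h1 := hsol Y Z Y.contMDiff Z.contMDiff p
  rw [← h.lieMetric_apply] at h1
  have h2 : h.solitonRho V lam mu nu Y Z p = -((1 / 2) * h.lieMetric V Y Z p
    + lam * S.g p (Y p) (Z p) + mu * S.gTilde p (Y p) (Z p)
    + nu * (S.eta p (Y p) * S.eta p (Z p))) := rfl
  rw [h2]
  linarith

variable [T2Space M]

/-- The algebraic Ricci-like soliton on the smooth vector fields. -/
def IsRicciLikeSoliton.alg (hS : IsSasakiLike S nabla) {V : Fld n M} {lam mu nu : ℝ}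
    (hsol : IsRicciLikeSoliton S nabla V lam mu nu) :
    (hS.alg h).Soliton (ι := Fin (2 * n + 1)) where
  v := V
  rho := h.solitonRho V lam mu nu
  lam := algebraMap ℝ (Fn n M) lam
  mu := algebraMap ℝ (Fn n M) mu
  nu := algebraMap ℝ (Fn n M) nu
  -- The dimension `2n + 1` is the trace of the identity, and `tr_R` leaves `(2n + 1) - 1` as the
  -- value of `ρ(ξ, ξ)`.
  m := algebraMap ℝ (Fn n M) (2 * n)
  der_lam X := h.der_algebraMap X lam
  der_mu X := h.der_algebraMap X mu
  der_nu X := h.der_algebraMap X nu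
  der_m X := h.der_algebraMap X _
  rho_tr f hf := by
    ext p
    obtain ⟨T, hT, htr⟩ := exists_traceFrame (n := n) p
    have h1 := hf T
      (fun Y Z => by
        ext q
        rw [htr q (h.curvatureHom Y Z q) _ fun X => (h.curvatureHom_apply X Y Z q).symm,
          fn_mul_apply, h.solitonRho_apply V lam mu nu hsol, h.ricci_eq_trace])
      (by
        ext q
        rw [htr q (S.phi q) _ fun X => rfl, S.trace_phi, mul_zero]
        rfl)
      (by
        ext q
        rw [htr q LinearMap.id id fun X => rfl, LinearMap.trace_id,
          Module.finrank_eq_card_basis (tanBasis q), Fintype.card_fin, mul_comm, fn_mul_apply,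
          fn_add_apply, algebraMap_apply, fn_one_apply]
        push_cast
        rfl)
    have h2 := congrArg (fun f : Fn n M => f p) h1
    simpa [sq, hT] using h2
  eqn Y Z := by
    change h.lieMetric V Y Z + 2 * (h.solitonRho V lam mu nu Y Z
      + algebraMap ℝ (Fn n M) lam * S.gL Y Z
      + algebraMap ℝ (Fn n M) mu * (S.gL Y (S.phiL Z) + S.etaL Y * S.etaL Z)
      + algebraMap ℝ (Fn n M) nu * (S.etaL Y * S.etaL Z)) = 0
    have h1 : (2 : Fn n M) * algebraMap ℝ (Fn n M) (1 / 2) = 1 := by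
      rw [← map_ofNat (algebraMap ℝ (Fn n M)) 2, ← map_mul]
      norm_num
    rw [IsLeviCivita.solitonRho]
    linear_combination -h.lieMetric V Y Z * h1

end BMetric

end

theorem theorem3p1 (n : ℕ) (hn : 1 ≤ n)
    (M : Type*) [TopologicalSpace M] [T2Space M] [Nonempty M]
    [ChartedSpace (BMetric.Model n) M] [IsManifold (𝓡 (2 * n + 1)) ∞ M]
    (S : BMetric.AlmostContactBMetric n M)
    (nabla : CovariantDerivative (𝓡 (2 * n + 1)) (BMetric.Model n)
      (TangentSpace (𝓡 (2 * n + 1)) : M → Type _))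
    (hnabla : BMetric.IsLeviCivita S.g nabla)
    (hS : BMetric.IsSasakiLike S nabla)
    (v : BMetric.VF n M) (hv : BMetric.SmoothVF v)
    (lam mu nu : ℝ)
    (hsol : BMetric.IsRicciLikeSoliton S nabla v lam mu nu) :
    lam + mu + nu = -2 * (n : ℝ) ∧
    (∀ p : M, BMetric.lieDerivVF v S.xi p = 0) ∧
    (∀ p : M, BMetric.covD nabla S.xi v p = -S.phi p (v p)) := by
  let V : BMetric.Fld n M := ⟨v, hv⟩
  have hV : BMetric.IsRicciLikeSoliton S nabla V lam mu nu := hsol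
  obtain ⟨h1, h2, h3⟩ := (hV.alg hnabla hS).conclusion
    (fun c hc => by
      ext p
      obtain ⟨Y, Z, hYZ⟩ := S.exists_g_phi_ne_zero hn p
      have h := congrArg (fun f : BMetric.Fn n M => f p) (hc Y Z)
      exact (mul_eq_zero.1 h).resolve_right hYZ)
    (fun c d hcd => by
      ext p
      obtain ⟨Y, Z, hYZ⟩ := S.exists_g_sub_ne_zero hn p
      have h := congrArg (fun f : BMetric.Fn n M => f p) (hcd Y Z)
      have h' : c p ^ 2 + d p ^ 2 = 0 := (mul_eq_zero.1 h).resolve_right hYZ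
      change d p = 0
      nlinarith [sq_nonneg (c p), sq_nonneg (d p)])
  obtain ⟨p₀⟩ := ‹Nonempty M›
  refine ⟨?_, fun p => ?_, fun p => ?_⟩
  · have h : 2 * (n : ℝ) + (lam + mu + nu) = 0 := congrArg (fun f : BMetric.Fn n M => f p₀) h1
    linarith
  · have h := congrArg (fun X : BMetric.Fld n M => (X : BMetric.VF n M)) h2
    have h' := congrFun ((hnabla.conn_br S V S.xiL).symm.trans h) p
    exact h'
  · exact congrArg (fun X : BMetric.Fld n M => X p) h3
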